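/- Let $k$ be an algebraically closed field with $\operatorname{char} k\neq 2$, let $H$ be a Hopf algebra over $k$, and let $V$ be a (left-left) Yetter--Drinfeld module over $H$ with basis $\{x_1,x_2\}=\{x,y\}$ in which the braiding $c(v\otimes w)=v_{(-1)}\cdot w\otimes v_{(0)}$ is diagonal: $c(x_i\otimes x_j)=b_{ij}\,x_j\otimes x_i$ with $b_{ij}\in k^\times$. Let $\mathfrak B(V)$ be the Nichols algebra of $V$, i.e. a graded braided Hopf algebra $R=\bigoplus_{i\ge 0}R(i)$ in the category of Yetter--Drinfeld modules over $H$ with $R(0)=k1$, with $R(1)=V$ equal to the space of primitive elements of $R$, and generated as an algebra by $R(1)$. For $u\in\mathfrak B(V)$ let $\mathrm{Ad}_u$ be the braided adjoint action, $\mathrm{Ad}_u(w)=\mu(\mu\otimes S)(\mathrm{id}\otimes c)(\Delta\otimes\mathrm{id})(u\otimes w)$. For $q\in k^\times$ let $N(q)$ be the order of $q$ if $q\ne1$ is a root of unity, $N(q)=\infty$ if $q$ is not a root of unity, $N(1)=\infty$ if $\operatorname{char}k=0$, and $N(1)=\operatorname{char}k$ if $\operatorname{char}k>0$. Suppose that $b_{12}b_{21}\neq1$,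 $b_{11}\neq1$, $b_{22}\neq1$, and that $N_i=N(b_{ii})<\infty$ for $i=1,2$. Put $z=\mathrm{Ad}_x(y)$ and $q=b_{11}b_{12}b_{21}b_{22}$. Then $z=xy-b_{12}yx$, and: 1. There is a positive integer $n$ with $(\mathrm{Ad}_x)^{n}(y)=0$, and the least such integer $n_{12}$ satisfies $n_{12}\le N_1$. If there is an integer $m\ge0$ with $b_{12}b_{21}b_{11}^{m}=1$ and $m_{12}$ is the least one, then $n_{12}=m_{12}+1$. Likewise there is a positive integer $n$ with $(\mathrm{Ad}_y)^{n}(x)=0$, the least such integer $n_{21}$ satisfies $n_{21}\le N_2$, and if there is an integer $m\ge0$ with $b_{12}b_{21}b_{22}^{m}=1$ and $m_{21}$ is the least one, then $n_{21}=m_{21}+1$. 2. If $q=1$ and $\operatorname{char}k=0$, then $z^n\neq0$ for all $n\ge 0$ and $\mathfrak B(V)$ is infinite-dimensional. If $q=1$ and $\operatorname{char}k>0$, then $\dim\mathfrak B(V)\ge N_1N_2\operatorname{char}k$. 3. If $b_{11}=b_{22}=-1$, then, with $N=N(q)$, $\dim\mathfrak B(V)=4N$ (infinite if $N=\infty$),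 and the elements $x^ay^bz^c$ with $0\le a,b<2$ and $0\le c<N$ form a basis of $\mathfrak B(V)$. -/

import Mathlib

open scoped TensorProduct

/-- A `k`-vector space `M` with an action of the algebra `H` and a linear map `M → H ⊗ M`.
The axioms making it a left-left Yetter--Drinfeld module are in `YDData.IsYetterDrinfeld`. -/
structure YDData (k : Type*) (H : Type*) (M : Type*) [Field k] [Ring H] [HopfAlgebra k H]
    [AddCommGroup M] [Module k M] where
  /-- the action `h ⊗ m ↦ h ▷ m` -/
  act : H →ₐ[k] Module.End k M
  /-- the coaction `δ(m) = m₍₋₁₎ ⊗ m₍₀₎` -/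
  coact : M →ₗ[k] H ⊗[k] M

namespace YDData

variable {k H M N : Type*} [Field k] [Ring H] [HopfAlgebra k H]
  [AddCommGroup M] [Module k M] [AddCommGroup N] [Module k N]

/-- The action as a linear map `H ⊗ M → M`. -/
noncomputable def actMap (D : YDData k H M) : H ⊗[k] M →ₗ[k] M :=
  TensorProduct.lift D.act.toLinearMap

variable (k H) in
/-- `a ↦ c ↦ (d ↦ a * d * S(c))`. -/
noncomputable def sandwich : H →ₗ[k] H →ₗ[k] Module.End k H :=
  LinearMap.mk₂ k
    (fun a c => LinearMap.mulLeft k a ∘ₗ LinearMap.mulRight k (HopfAlgebra.antipode k c))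
    (fun a a' c => by ext d; simp [add_mul])
    (fun r a c => by ext d; simp)
    (fun a c c' => by ext d; simp [mul_add])
    (fun r a c => by ext d; simp)

/-- `(a ⊗ b) ⊗ c ↦ (d ⊗ m ↦ a * d * S(c) ⊗ b ▷ m)`. -/
noncomputable def twist (D : YDData k H M) :
    (H ⊗[k] H) ⊗[k] H →ₗ[k] H ⊗[k] M →ₗ[k] H ⊗[k] M :=
  TensorProduct.homTensorHomMap (RingHom.id k) H M H M ∘ₗ
    TensorProduct.map (TensorProduct.lift (sandwich k H)) D.act.toLinearMap ∘ₗ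
    (TensorProduct.rightComm k H H H).toLinearMap

/-- The axioms of a left-left Yetter--Drinfeld module over `H`: `M` is a left `H`-comodule and
`δ(h ▷ m) = h₍₁₎ m₍₋₁₎ S(h₍₃₎) ⊗ h₍₂₎ ▷ m₍₀₎`. -/
structure IsYetterDrinfeld (D : YDData k H M) : Prop where
  counit_coact : ∀ m, TensorProduct.lid k M
    ((Coalgebra.counit (R := k) (A := H)).rTensor M (D.coact m)) = m
  coassoc : ∀ m, TensorProduct.assoc k H H M
    ((Coalgebra.comul (R := k) (A := H)).rTensor M (D.coact m)) =
      D.coact.lTensor H (D.coact m)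
  compat : ∀ (h : H) (m : M), D.coact (D.act h m) =
    D.twist ((Coalgebra.comul (R := k) (A := H)).rTensor H (Coalgebra.comul (R := k) h))
      (D.coact m)

/-- The tensor product: `h ▷ (m ⊗ n) = h₍₁₎ ▷ m ⊗ h₍₂₎ ▷ n` and
`δ(m ⊗ n) = m₍₋₁₎ n₍₋₁₎ ⊗ (m₍₀₎ ⊗ n₍₀₎)`. -/
noncomputable def tensor (D : YDData k H M) (E : YDData k H N) : YDData k H (M ⊗[k] N) where
  act := (Module.endTensorEndAlgHom (R := k) (S := k) (A := k) (M := M) (N := N)).comp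
    ((Algebra.TensorProduct.map D.act E.act).comp (Bialgebra.comulAlgHom k H))
  coact := (LinearMap.mul' k H).rTensor (M ⊗[k] N) ∘ₗ
    (TensorProduct.tensorTensorTensorComm k H M H N).toLinearMap ∘ₗ
    TensorProduct.map D.coact E.coact

variable (k H) in
/-- The unit object `k`: `h ▷ t = ε(h) t` and `δ(t) = 1 ⊗ t`. -/
noncomputable def unit : YDData k H k where
  act := (Algebra.lmul k k).comp (Bialgebra.counitAlgHom k H)
  coact := TensorProduct.mk k H k 1

/-- Morphisms are the `H`-linear and `H`-colinear maps. -/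
structure IsHom (D : YDData k H M) (E : YDData k H N) (f : M →ₗ[k] N) : Prop where
  map_act : ∀ h m, f (D.act h m) = E.act h (f m)
  map_coact : ∀ m, E.coact (f m) = f.lTensor H (D.coact m)

/-- The braiding `c(m ⊗ n) = m₍₋₁₎ ▷ n ⊗ m₍₀₎`. -/
noncomputable def braiding (D : YDData k H M) (E : YDData k H N) :
    M ⊗[k] N →ₗ[k] N ⊗[k] M :=
  E.actMap.rTensor M ∘ₗ (TensorProduct.rightComm k H M N).toLinearMap ∘ₗ D.coact.rTensor N

/-- `M` has the matrix `b` in the basis `e`: `c(eᵢ ⊗ eⱼ) = bᵢⱼ eⱼ ⊗ eᵢ`. -/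
def HasMatrix {ι : Type*} (D : YDData k H M) (e : Module.Basis ι k M) (b : ι → ι → kˣ) : Prop :=
  ∀ i j, D.braiding D (e i ⊗ₜ[k] e j) = (b i j : k) • (e j ⊗ₜ[k] e i)

end YDData

section BraidedHopf

variable {k H R : Type*} [Field k] [Ring H] [HopfAlgebra k H] [Ring R] [Algebra k R]

/-- The braided tensor product multiplication on `R ⊗ R`, that is
`(μ ⊗ μ)(id ⊗ c ⊗ id) : (R ⊗ R) ⊗ (R ⊗ R) → R ⊗ R`. -/
noncomputable def braidedTensorMul (D : YDData k H R) :
    (R ⊗[k] R) ⊗[k] (R ⊗[k] R) →ₗ[k] R ⊗[k] R :=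
  TensorProduct.map (LinearMap.mul' k R) (LinearMap.mul' k R) ∘ₗ
    (TensorProduct.assoc k R R (R ⊗[k] R)).symm.toLinearMap ∘ₗ
    ((TensorProduct.assoc k R R R).toLinearMap ∘ₗ
      (D.braiding D).rTensor R ∘ₗ
      (TensorProduct.assoc k R R R).symm.toLinearMap).lTensor R ∘ₗ
    (TensorProduct.assoc k R R (R ⊗[k] R)).toLinearMap

variable [Coalgebra k R]

/-- `R` (an algebra and a coalgebra, with Yetter--Drinfeld structure `D`) is a braided Hopf
algebra in the category of Yetter--Drinfeld modules over `H`, with antipode `S`. -/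
structure IsBraidedHopfAlgebra (D : YDData k H R) (S : R →ₗ[k] R) : Prop where
  isYetterDrinfeld : D.IsYetterDrinfeld
  mul_hom : (D.tensor D).IsHom D (LinearMap.mul' k R)
  one_hom : (YDData.unit k H).IsHom D (Algebra.linearMap k R)
  comul_hom : D.IsHom (D.tensor D) (Coalgebra.comul (R := k) (A := R))
  counit_hom : D.IsHom (YDData.unit k H) (Coalgebra.counit (R := k) (A := R))
  antipode_hom : D.IsHom D S
  comul_one : Coalgebra.comul (R := k) (1 : R) = 1 ⊗ₜ[k] 1
  comul_mul : ∀ a b : R, Coalgebra.comul (R := k) (a * b) =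
    braidedTensorMul D (Coalgebra.comul (R := k) a ⊗ₜ[k] Coalgebra.comul (R := k) b)
  counit_one : Coalgebra.counit (R := k) (1 : R) = 1
  counit_mul : ∀ a b : R, Coalgebra.counit (R := k) (a * b) =
    Coalgebra.counit (R := k) a * Coalgebra.counit (R := k) b
  antipode_left : ∀ a : R, LinearMap.mul' k R (S.rTensor R (Coalgebra.comul (R := k) a)) =
    algebraMap k R (Coalgebra.counit (R := k) a)
  antipode_right : ∀ a : R, LinearMap.mul' k R (S.lTensor R (Coalgebra.comul (R := k) a)) =
    algebraMap k R (Coalgebra.counit (R := k) a)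

/-- `R = ⨁ᵢ 𝒜 i` is a graded braided Hopf algebra: the `𝒜 i` are Yetter--Drinfeld submodules
and all the structure maps are homogeneous. -/
structure IsGradedBraidedHopfAlgebra (D : YDData k H R) (S : R →ₗ[k] R)
    (𝒜 : ℕ → Submodule k R) : Prop extends IsBraidedHopfAlgebra D S where
  isInternal : DirectSum.IsInternal 𝒜
  act_mem : ∀ n (h : H), ∀ a ∈ 𝒜 n, D.act h a ∈ 𝒜 n
  coact_mem : ∀ n, ∀ a ∈ 𝒜 n, D.coact a ∈ LinearMap.range ((𝒜 n).subtype.lTensor H)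
  one_mem : (1 : R) ∈ 𝒜 0
  mul_mem : ∀ m n, ∀ a ∈ 𝒜 m, ∀ b ∈ 𝒜 n, a * b ∈ 𝒜 (m + n)
  comul_mem : ∀ n, ∀ a ∈ 𝒜 n, Coalgebra.comul (R := k) a ∈
    ⨆ (p : ℕ × ℕ) (_ : p.1 + p.2 = n),
      LinearMap.range (TensorProduct.map (𝒜 p.1).subtype (𝒜 p.2).subtype)
  counit_eq_zero : ∀ n, n ≠ 0 → ∀ a ∈ 𝒜 n, Coalgebra.counit (R := k) a = 0
  antipode_mem : ∀ n, ∀ a ∈ 𝒜 n, S a ∈ 𝒜 n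

/-- `R` is a Nichols algebra of the Yetter--Drinfeld module `V`: a graded braided Hopf algebra
with `R(0) = k 1`, with `P(R) = R(1)` for the space `P(R)` of primitive elements, generated as
an algebra by `R(1)`, and `R(1) = V` via `incl`. -/
structure IsNicholsAlgebra {V : Type*} [AddCommGroup V] [Module k V] (DV : YDData k H V)
    (D : YDData k H R) (S : R →ₗ[k] R) (𝒜 : ℕ → Submodule k R) (incl : V →ₗ[k] R) : Prop
    extends IsGradedBraidedHopfAlgebra D S 𝒜 where
  zero_eq : 𝒜 0 = Submodule.span k {1}
  primitive_iff : ∀ a : R, Coalgebra.comul (R := k) a = a ⊗ₜ[k] 1 + 1 ⊗ₜ[k] a ↔ a ∈ 𝒜 1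
  adjoin_eq_top : Algebra.adjoin k (𝒜 1 : Set R) = ⊤
  incl_hom : DV.IsHom D incl
  incl_injective : Function.Injective incl
  range_incl : LinearMap.range incl = 𝒜 1

/-- The braided adjoint action `Ad_x(y) = μ(μ ⊗ S)(id ⊗ c)(Δ ⊗ id)(x ⊗ y)`. -/
noncomputable def braidedAd (D : YDData k H R) (S : R →ₗ[k] R) (x : R) : R →ₗ[k] R :=
  LinearMap.mul' k R ∘ₗ TensorProduct.map (LinearMap.mul' k R) S ∘ₗ
    (TensorProduct.assoc k R R R).symm.toLinearMap ∘ₗ (D.braiding D).lTensor R ∘ₗ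
    (TensorProduct.assoc k R R R).toLinearMap ∘ₗ
    (Coalgebra.comul (R := k) (A := R)).rTensor R ∘ₗ TensorProduct.mk k R R x

end BraidedHopf

open Classical in
/-- `N(q)`: the order of `q` if `q ≠ 1` is a root of unity, `∞` if `q` is not a root of unity,
`∞` if `q = 1` and `char k = 0`, and `char k` if `q = 1` and `char k > 0`. -/
noncomputable def nicholsN {k : Type*} [Field k] (q : kˣ) : ℕ∞ :=
  if q = 1 then (if ringChar k = 0 then ⊤ else (ringChar k : ℕ∞))
  else if IsOfFinOrder q then (orderOf q : ℕ∞) else ⊤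

/-! Write `∂ᵢ = (id ⊗ φᵢ)Δ`, where `φᵢ` reads off the `i`-th coordinate in degree one. Because the
braiding is diagonal, `xᵢ` braids past everything through an algebra endomorphism `gᵢ` with `gᵢ(xⱼ)
= bᵢⱼ xⱼ`, and `∂ᵢ(ac) = a ∂ᵢ(c) + ∂ᵢ(a) gᵢ(c)`. Since all primitives lie in degree one, an element
of positive degree killed by every `∂ᵢ` is zero (`eq_zero_of_skewDer_eq_zero`). After this only
these rules, packaged in `IsSkewDual`, and the grading are used.

Part 1: `∂₁` kills `(Ad x₁)ⁿ(x₂)`, and `∂₂` sends it to `∏_{m<n} (1 - b₁₂b₂₁b₁₁ᵐ) · x₁ⁿ`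
(`der_ad_pow`), so vanishing is read off from the factors and from the nilpotency of `x₁`.

Part 2: `∂₁`, `∂₂` and `∂₁∂₂` lower the exponents of `x`, `y` and `z` respectively, with
`q`-integers as coefficients, so the monomials `xᵃyᵇzᶜ` with exponents below `N(b₁₁)`, `N(b₂₂)`,
`N(q)` are independent (`linearIndependent_monomials`).

Part 3: if `b₁₁ = b₂₂ = -1`, then `x² = y² = 0` and `z^N(q) = 0`; the span of the monomials is a
left ideal containing `1`, hence everything. -/

section Slice

variable {k M N : Type*} [Field k] [AddCommGroup M] [Module k M] [AddCommGroup N] [Module k N]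

/-- Contraction of the right tensor factor with a linear functional. -/
noncomputable def sliceRight (M : Type*) [AddCommGroup M] [Module k M] (f : N →ₗ[k] k) :
    M ⊗[k] N →ₗ[k] M :=
  (TensorProduct.rid k M).toLinearMap ∘ₗ f.lTensor M

@[simp] lemma sliceRight_tmul (f : N →ₗ[k] k) (m : M) (n : N) :
    sliceRight M f (m ⊗ₜ n) = f n • m := by
  simp [sliceRight]

end Slice

/-! ### Homogeneous components. -/

section Graded

variable {k R : Type*} [Field k] [AddCommGroup R] [Module k R]

/-- The homogeneous component of degree `n`, as an endomorphism. -/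
noncomputable def gradedProj {𝒜 : ℕ → Submodule k R} (h𝒜 : DirectSum.IsInternal 𝒜) (n : ℕ) :
    R →ₗ[k] R :=
  (𝒜 n).subtype ∘ₗ DirectSum.component k ℕ (fun i => 𝒜 i) n ∘ₗ
    (LinearEquiv.ofBijective (DirectSum.coeLinearMap 𝒜) h𝒜).symm.toLinearMap

variable {𝒜 : ℕ → Submodule k R} (h𝒜 : DirectSum.IsInternal 𝒜)

lemma gradedProj_mem (n : ℕ) (a : R) : gradedProj h𝒜 n a ∈ 𝒜 n := by
  simp [gradedProj]

lemma gradedProj_of_mem {m : ℕ} {a : R} (ha : a ∈ 𝒜 m) (n : ℕ) :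
    gradedProj h𝒜 n a = if m = n then a else 0 := by
  have : (LinearEquiv.ofBijective (DirectSum.coeLinearMap 𝒜) h𝒜).symm a =
      DirectSum.lof k ℕ (fun i => 𝒜 i) m ⟨a, ha⟩ := by
    rw [LinearEquiv.symm_apply_eq]
    exact (DirectSum.coeLinearMap_lof 𝒜 m ⟨a, ha⟩).symm
  simp only [gradedProj, LinearMap.comp_apply, LinearEquiv.coe_coe, this]
  rw [DirectSum.component.of]
  split_ifs with h
  · subst h
    rfl
  · rfl

include h𝒜 in
lemma graded_ext {M : Type*} [AddCommGroup M] [Module k M] {f g : R →ₗ[k] M}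
    (h : ∀ n, ∀ a ∈ 𝒜 n, f a = g a) : f = g := by
  have : (⊤ : Submodule k R) ≤ LinearMap.eqLocus f g := by
    rw [← h𝒜.submodule_iSup_eq_top]
    exact iSup_le fun n a ha => h n a ha
  ext a
  exact this trivial

end Graded

/-! ### Braidings and the formal consequences of the braided Hopf axioms. -/

namespace YDData

variable {k H M N : Type*} [Field k] [Ring H] [HopfAlgebra k H]
  [AddCommGroup M] [Module k M] [AddCommGroup N] [Module k N]

/-- Translates statements about the braiding into statements about the action of elements of `H`;
the diagonality hypothesis and the twist in the product rule both enter through it. -/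
lemma sliceRight_braiding (D : YDData k H M) (E : YDData k H N) (f : M →ₗ[k] k) (u : M) (w : N) :
    sliceRight N f (D.braiding E (u ⊗ₜ w)) = E.act (sliceRight H f (D.coact u)) w := by
  simp only [braiding, LinearMap.comp_apply, LinearMap.rTensor_tmul]
  induction D.coact u with
  | zero => simp
  | add s t hs ht => simp only [TensorProduct.add_tmul, map_add, hs, ht, LinearMap.add_apply]
  | tmul h m => simp [actMap]

lemma IsHom.braiding {M' N' : Type*} [AddCommGroup M'] [Module k M'] [AddCommGroup N'] [Module k N']
    {D : YDData k H M} {E : YDData k H N} {D' : YDData k H M'} {E' : YDData k H N'}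
    {f : M →ₗ[k] M'} {g : N →ₗ[k] N'} (hf : D.IsHom D' f) (hg : E.IsHom E' g) (u : M) (w : N) :
    D'.braiding E' (f u ⊗ₜ g w) = TensorProduct.map g f (D.braiding E (u ⊗ₜ w)) := by
  simp only [YDData.braiding, LinearMap.comp_apply, LinearMap.rTensor_tmul, hf.map_coact]
  induction D.coact u with
  | zero => simp
  | add s t hs ht => simp only [TensorProduct.add_tmul, map_add, hs, ht]
  | tmul h m => simp [actMap, hg.map_act]

end YDData

section BraidedHopf

variable {k H R : Type*} [Field k] [Ring H] [HopfAlgebra k H] [Ring R] [Algebra k R]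
  [Coalgebra k R] {D : YDData k H R} {S : R →ₗ[k] R}

namespace IsBraidedHopfAlgebra

variable (hR : IsBraidedHopfAlgebra D S)
include hR

lemma act_one (h : H) : D.act h 1 = Coalgebra.counit (R := k) h • (1 : R) := by
  have := hR.one_hom.map_act h 1
  simp only [YDData.unit, Algebra.linearMap_apply, map_one] at this
  rw [← this]
  simp [Algebra.smul_def]

lemma act_mul (h : H) (a c : R) : D.act h (a * c) =
    LinearMap.mul' k R (TensorProduct.map (LinearMap.applyₗ a ∘ₗ D.act.toLinearMap)
      (LinearMap.applyₗ c ∘ₗ D.act.toLinearMap) (Coalgebra.comul (R := k) h)) := by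
  have := hR.mul_hom.map_act h (a ⊗ₜ c)
  rw [LinearMap.mul'_apply] at this
  rw [← this]
  congr 1
  simp only [YDData.tensor, AlgHom.comp_apply, Bialgebra.comulAlgHom_apply]
  induction Coalgebra.comul (R := k) h with
  | zero => simp
  | add s t hs ht => simp only [map_add, hs, ht, LinearMap.add_apply]
  | tmul s t =>
    rw [Algebra.TensorProduct.map_tmul, Module.endTensorEndAlgHom_apply]
    simp

lemma coact_one : D.coact 1 = 1 ⊗ₜ 1 := by
  have := hR.one_hom.map_coact 1
  simpa [YDData.unit] using this

lemma braiding_one (w : R) : D.braiding D (1 ⊗ₜ w) = w ⊗ₜ 1 := by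
  simp [YDData.braiding, hR.coact_one, YDData.actMap]

lemma sliceRight_counit_coact (u : R) :
    sliceRight H (Coalgebra.counit (R := k) (A := R)) (D.coact u) =
      Coalgebra.counit (R := k) u • (1 : H) := by
  have := hR.counit_hom.map_coact u
  simp only [YDData.unit, TensorProduct.mk_apply] at this
  simp [sliceRight, ← this]

lemma antipode_one : S 1 = 1 := by
  simpa [hR.comul_one, hR.counit_one] using hR.antipode_left 1

lemma antipode_of_primitive {a : R} (ha : Coalgebra.comul (R := k) a = a ⊗ₜ[k] 1 + 1 ⊗ₜ[k] a)
    (ha0 : Coalgebra.counit (R := k) a = 0) : S a = -a := by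
  have := hR.antipode_left a
  rw [ha, ha0] at this
  simp only [map_add, LinearMap.rTensor_tmul, LinearMap.mul'_apply, hR.antipode_one, mul_one,
    one_mul, map_zero] at this
  exact eq_neg_of_add_eq_zero_left this

lemma braidedAd_of_primitive {a : R}
    (ha : Coalgebra.comul (R := k) a = a ⊗ₜ[k] 1 + 1 ⊗ₜ[k] a) (w : R) :
    braidedAd D S a w = a * w +
      LinearMap.mul' k R (S.lTensor R (D.braiding D (a ⊗ₜ w))) := by
  simp only [braidedAd, LinearMap.comp_apply, TensorProduct.mk_apply, LinearMap.rTensor_tmul, ha,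
    TensorProduct.add_tmul, map_add, LinearEquiv.coe_coe, TensorProduct.assoc_tmul,
    LinearMap.lTensor_tmul, hR.braiding_one, TensorProduct.assoc_symm_tmul, TensorProduct.map_tmul,
    LinearMap.mul'_apply, hR.antipode_one, mul_one]
  congr 1
  induction D.braiding D (a ⊗ₜ w) with
  | zero => simp
  | add s t hs ht => simp only [TensorProduct.tmul_add, map_add, hs, ht]
  | tmul s t => simp

end IsBraidedHopfAlgebra

end BraidedHopf

/-! ### Nichols algebras of diagonal type: coordinates and characters. -/

namespace IsNicholsAlgebra

variable {k H R V ι : Type*} [Field k] [Ring H] [HopfAlgebra k H] [Ring R] [Algebra k R]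
  [Coalgebra k R] [AddCommGroup V] [Module k V] {DV : YDData k H V} {D : YDData k H R}
  {S : R →ₗ[k] R} {𝒜 : ℕ → Submodule k R} {incl : V →ₗ[k] R}
  (hR : IsNicholsAlgebra DV D S 𝒜 incl) (e : Module.Basis ι k V)

/-- The `i`-th coordinate of the component of degree one. -/
noncomputable def coordOne (i : ι) : R →ₗ[k] k :=
  e.coord i ∘ₗ (LinearMap.exists_leftInverse_of_injective incl
    (LinearMap.ker_eq_bot.2 hR.incl_injective)).choose ∘ₗ gradedProj hR.isInternal 1

include hR in
lemma incl_mem (v : V) : incl v ∈ 𝒜 1 := hR.range_incl ▸ LinearMap.mem_range_self incl v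

lemma coordOne_incl (i : ι) (v : V) : hR.coordOne e i (incl v) = e.coord i v := by
  have := LinearMap.congr_fun (LinearMap.exists_leftInverse_of_injective incl
    (LinearMap.ker_eq_bot.2 hR.incl_injective)).choose_spec v
  simp only [LinearMap.comp_apply, LinearMap.id_apply] at this
  simp only [coordOne, LinearMap.comp_apply, gradedProj_of_mem hR.isInternal (hR.incl_mem v),
    if_true, this]

lemma coordOne_incl_basis [DecidableEq ι] (i j : ι) :
    hR.coordOne e i (incl (e j)) = if j = i then 1 else 0 := by
  rw [coordOne_incl, Module.Basis.coord_apply, Module.Basis.repr_self, Finsupp.single_apply]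

lemma coordOne_of_mem {n : ℕ} (hn : n ≠ 1) (i : ι) {a : R} (ha : a ∈ 𝒜 n) :
    hR.coordOne e i a = 0 := by
  simp [coordOne, gradedProj_of_mem hR.isInternal ha, hn]

lemma sum_coordOne [Fintype ι] {a : R} (ha : a ∈ 𝒜 1) :
    ∑ i, hR.coordOne e i a • incl (e i) = a := by
  rw [← hR.range_incl] at ha
  obtain ⟨v, rfl⟩ := ha
  simp_rw [coordOne_incl, ← map_smul, ← map_sum]
  congr 1
  exact e.sum_repr v

/-- As `R(0) = k`, the degree-one part of a product only sees bidegrees `(0,1)` and `(1,0)`. -/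
lemma coordOne_mul (i : ι) (a c : R) : hR.coordOne e i (a * c) =
    hR.coordOne e i a * Coalgebra.counit (R := k) c +
      Coalgebra.counit (R := k) a * hR.coordOne e i c := by
  have key : (LinearMap.mul k R).compr₂ (hR.coordOne e i) =
      (LinearMap.mul k k).compl₁₂ (hR.coordOne e i) (Coalgebra.counit (R := k) (A := R)) +
      (LinearMap.mul k k).compl₁₂ (Coalgebra.counit (R := k) (A := R)) (hR.coordOne e i) := by
    refine graded_ext hR.isInternal fun m a ha => graded_ext hR.isInternal fun n c hc => ?_
    simp only [LinearMap.compr₂_apply, LinearMap.mul_apply', LinearMap.add_apply,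
      LinearMap.compl₁₂_apply]
    by_cases hm : m = 0
    · subst hm
      rw [hR.zero_eq, Submodule.mem_span_singleton] at ha
      obtain ⟨r, rfl⟩ := ha
      have h1 := hR.coordOne_of_mem e zero_ne_one i hR.one_mem
      simp [h1, hR.counit_one]
    by_cases hn : n = 0
    · subst hn
      rw [hR.zero_eq, Submodule.mem_span_singleton] at hc
      obtain ⟨r, rfl⟩ := hc
      have h1 := hR.coordOne_of_mem e zero_ne_one i hR.one_mem
      simp [h1, hR.counit_one, mul_comm]
    rw [hR.coordOne_of_mem e (by omega) i (hR.mul_mem m n a ha c hc),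
      hR.counit_eq_zero m hm a ha, hR.counit_eq_zero n hn c hc]
    simp
  exact LinearMap.congr_fun₂ key a c

/-- The matrix coefficients of the coaction on `V`: `δ(eⱼ) = ∑ᵢ hⱼᵢ ⊗ eᵢ`. -/
noncomputable def coeff (j i : ι) : H := sliceRight H (hR.coordOne e i) (D.coact (incl (e j)))

lemma coact_incl_basis [Fintype ι] (j : ι) :
    D.coact (incl (e j)) = ∑ i, hR.coeff e j i ⊗ₜ incl (e i) := by
  obtain ⟨t, ht⟩ := hR.coact_mem 1 _ (hR.incl_mem (e j))
  have key : ∀ t : H ⊗[k] 𝒜 1, (𝒜 1).subtype.lTensor H t =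
      ∑ i, sliceRight H (hR.coordOne e i) ((𝒜 1).subtype.lTensor H t) ⊗ₜ[k] incl (e i) := by
    intro t
    induction t with
    | zero => simp
    | add s t hs ht =>
      simp only [map_add, TensorProduct.add_tmul, Finset.sum_add_distrib, ← hs, ← ht]
    | tmul h a =>
      simp only [LinearMap.lTensor_tmul, Submodule.subtype_apply, sliceRight_tmul,
        TensorProduct.smul_tmul, ← TensorProduct.tmul_sum, hR.sum_coordOne e a.2]
  simp only [coeff]
  rw [← ht]
  exact key t

lemma comul_coeff [Fintype ι] [DecidableEq ι] (j i : ι) :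
    Coalgebra.comul (R := k) (hR.coeff e j i) = ∑ l, hR.coeff e j l ⊗ₜ[k] hR.coeff e l i := by
  have h := hR.isYetterDrinfeld.coassoc (incl (e j))
  simp only [hR.coact_incl_basis e, map_sum, LinearMap.rTensor_tmul, LinearMap.lTensor_tmul,
    TensorProduct.tmul_sum] at h
  have h2 := congrArg (sliceRight (H ⊗[k] H) (hR.coordOne e i) ∘ₗ
    (TensorProduct.assoc k H H R).symm.toLinearMap) h
  simpa [hR.coordOne_incl_basis] using h2

lemma counit_coeff [Fintype ι] [DecidableEq ι] (j i : ι) :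
    Coalgebra.counit (R := k) (hR.coeff e j i) = if j = i then 1 else 0 := by
  have h := hR.isYetterDrinfeld.counit_coact (incl (e j))
  simp only [hR.coact_incl_basis e, map_sum, LinearMap.rTensor_tmul, TensorProduct.lid_tmul] at h
  have h2 := congrArg (hR.coordOne e i) h
  simpa [hR.coordOne_incl_basis] using h2

variable [DecidableEq ι] {b : ι → ι → kˣ} (hb : DV.HasMatrix e b)
include hb

/-- Only the braiding is diagonal, not the coaction: the off-diagonal coefficients may be nonzero in
`H`, and it is merely their action that vanishes. -/
lemma act_coeff_basis (j i m : ι) :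
    D.act (hR.coeff e j i) (incl (e m)) = if j = i then (b j m : k) • incl (e m) else 0 := by
  rw [coeff, ← YDData.sliceRight_braiding, hR.incl_hom.braiding hR.incl_hom, hb j m]
  simp [hR.coordOne_incl_basis]

variable [Fintype ι]

/-- The coefficients `hⱼᵢ` form a matrix coalgebra, so `hⱼᵢ` acts on `ac` by `∑ₗ (hⱼₗ a)(hₗᵢ c)`.
For `l ≠ j` the first factor vanishes, for `l = j` the second. -/
lemma act_coeff_eq_zero {j i : ι} (hji : j ≠ i) (a : R) : D.act (hR.coeff e j i) a = 0 := by
  have ha : a ∈ Algebra.adjoin k (𝒜 1 : Set R) := by rw [hR.adjoin_eq_top]; trivial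
  induction ha using Algebra.adjoin_induction generalizing j i with
  | mem a ha =>
    rw [← hR.sum_coordOne e ha]
    simp [hR.act_coeff_basis e hb, hji]
  | algebraMap r =>
    rw [Algebra.algebraMap_eq_smul_one, map_smul, hR.act_one, hR.counit_coeff, if_neg hji]
    simp
  | add a c _ _ iha ihc => rw [map_add, iha hji, ihc hji, add_zero]
  | mul a c _ _ iha ihc =>
    rw [hR.act_mul, hR.comul_coeff]
    simp only [map_sum, TensorProduct.map_tmul, LinearMap.mul'_apply, LinearMap.comp_apply,
      AlgHom.toLinearMap_apply, LinearMap.applyₗ_apply_apply]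
    refine Finset.sum_eq_zero fun l _ => ?_
    by_cases hl : j = l
    · rw [ihc (hl ▸ hji), mul_zero]
    · rw [iha hl, zero_mul]

/-- The algebra endomorphism of the Nichols algebra by which `x i` braids. -/
noncomputable def charHom (i : ι) : R →ₐ[k] R :=
  AlgHom.ofLinearMap (D.act (hR.coeff e i i)) (by simp [hR.act_one, hR.counit_coeff]) (by
    intro a c
    -- Off-diagonal coefficients act by zero, so `hᵢᵢ` acts as if it were group-like.
    rw [hR.act_mul, hR.comul_coeff, map_sum, map_sum, Finset.sum_eq_single i]
    · simp
    · intro l _ hl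
      simp [hR.act_coeff_eq_zero e hb hl]
    · simp)

lemma charHom_apply (i : ι) (a : R) : hR.charHom e hb i a = D.act (hR.coeff e i i) a := rfl

lemma charHom_basis (i j : ι) :
    hR.charHom e hb i (incl (e j)) = (b i j : k) • incl (e j) := by
  rw [charHom_apply, hR.act_coeff_basis e hb, if_pos rfl]

/-- The coaction preserves degree, so only the degree-one component of `u` contributes. -/
lemma act_slice_coact (i : ι) (u w : R) :
    D.act (sliceRight H (hR.coordOne e i) (D.coact u)) w =
      hR.coordOne e i u • hR.charHom e hb i w := by
  have key : LinearMap.applyₗ w ∘ₗ D.act.toLinearMap ∘ₗ sliceRight H (hR.coordOne e i) ∘ₗ D.coact =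
      (hR.coordOne e i).smulRight (hR.charHom e hb i w) := by
    refine graded_ext hR.isInternal fun n u hu => ?_
    by_cases hn : n = 1
    · subst hn
      rw [← hR.sum_coordOne e hu]
      simp only [map_sum, map_smul]
      refine Finset.sum_congr rfl fun j _ => ?_
      congr 1
      simp only [LinearMap.comp_apply, AlgHom.toLinearMap_apply, LinearMap.applyₗ_apply_apply,
        LinearMap.smulRight_apply, hR.coordOne_incl_basis]
      by_cases hji : j = i
      · subst hji
        simp [charHom_apply, coeff]
      · rw [if_neg hji, zero_smul]
        exact hR.act_coeff_eq_zero e hb hji w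
    · obtain ⟨t, ht⟩ := hR.coact_mem n u hu
      have : sliceRight H (hR.coordOne e i) ∘ₗ (𝒜 n).subtype.lTensor H = 0 := by
        ext h a
        simp [hR.coordOne_of_mem e hn i a.2]
      have h2 := LinearMap.congr_fun this t
      simp only [LinearMap.comp_apply, ht] at h2
      simp [h2, hR.coordOne_of_mem e hn i hu]
  exact LinearMap.congr_fun key u

lemma braiding_basis (i : ι) (w : R) :
    D.braiding D (incl (e i) ⊗ₜ w) = hR.charHom e hb i w ⊗ₜ incl (e i) := by
  simp only [YDData.braiding, LinearMap.comp_apply, LinearMap.rTensor_tmul,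
    hR.coact_incl_basis e, TensorProduct.sum_tmul, map_sum, LinearEquiv.coe_coe,
    TensorProduct.rightComm_tmul, YDData.actMap, TensorProduct.lift.tmul,
    AlgHom.toLinearMap_apply]
  rw [Finset.sum_eq_single i]
  · rfl
  · intro l _ hl
    rw [hR.act_coeff_eq_zero e hb hl.symm, TensorProduct.zero_tmul]
  · simp

lemma braidedAd_basis (i : ι) (w : R) :
    braidedAd D S (incl (e i)) w = incl (e i) * w - hR.charHom e hb i w * incl (e i) := by
  have hp := (hR.primitive_iff _).2 (hR.incl_mem (e i))
  rw [hR.braidedAd_of_primitive hp, hR.braiding_basis e hb, LinearMap.lTensor_tmul,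
    hR.antipode_of_primitive hp (hR.counit_eq_zero 1 one_ne_zero _ (hR.incl_mem _))]
  simp [sub_eq_add_neg]

/-! ### Skew derivations and their common kernel. -/

omit hb [DecidableEq ι] [Fintype ι] in
/-- The skew derivation `∂ᵢ = (id ⊗ φᵢ) Δ`. -/
noncomputable def skewDer (i : ι) : R →ₗ[k] R :=
  sliceRight R (hR.coordOne e i) ∘ₗ Coalgebra.comul

/-- The product rule before specializing to coproducts. By `coordOne_mul`, `φᵢ` falls on one
right-hand leg and the counit on the other. Where the left factor's leg meets the counit, the
braiding becomes trivial; where it meets `φᵢ`, it becomes `charHom`. -/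
lemma slice_braidedTensorMul (i : ι) (s t : R ⊗[k] R) :
    sliceRight R (hR.coordOne e i) (braidedTensorMul D (s ⊗ₜ t)) =
      sliceRight R (Coalgebra.counit (R := k)) s * sliceRight R (hR.coordOne e i) t +
      sliceRight R (hR.coordOne e i) s *
        hR.charHom e hb i (sliceRight R (Coalgebra.counit (R := k)) t) := by
  induction s with
  | zero => simp
  | add s s' hs hs' =>
    rw [TensorProduct.add_tmul, map_add, map_add, hs, hs']
    simp only [map_add, add_mul]
    abel
  | tmul a₁ a₂ =>
    induction t with
    | zero => simp
    | add t t' ht ht' =>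
      rw [TensorProduct.tmul_add, map_add, map_add, ht, ht']
      simp only [map_add, mul_add]
      abel
    | tmul b₁ b₂ =>
      have key : ∀ r : R ⊗[k] R, sliceRight R (hR.coordOne e i)
          (TensorProduct.map (LinearMap.mul' k R) (LinearMap.mul' k R)
            ((TensorProduct.assoc k R R (R ⊗[k] R)).symm
              (a₁ ⊗ₜ TensorProduct.assoc k R R R (r ⊗ₜ b₂)))) =
          Coalgebra.counit (R := k) b₂ • (a₁ * sliceRight R (hR.coordOne e i) r) +
          hR.coordOne e i b₂ • (a₁ * sliceRight R (Coalgebra.counit (R := k)) r) := by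
        intro r
        induction r with
        | zero => simp
        | add r r' h h' =>
          simp only [TensorProduct.add_tmul, TensorProduct.tmul_add, map_add, h, h', mul_add,
            smul_add]
          abel
        | tmul c d =>
          simp only [TensorProduct.assoc_tmul, TensorProduct.assoc_symm_tmul,
            TensorProduct.map_tmul, LinearMap.mul'_apply, sliceRight_tmul, hR.coordOne_mul,
            mul_smul_comm, smul_smul, add_smul]
          rw [mul_comm (hR.coordOne e i d), mul_comm (hR.coordOne e i b₂)]
      have := key (D.braiding D (a₂ ⊗ₜ b₁))
      simp only [YDData.sliceRight_braiding, hR.act_slice_coact e hb,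
        hR.sliceRight_counit_coact] at this
      simp only [braidedTensorMul, LinearMap.comp_apply, LinearEquiv.coe_coe,
        TensorProduct.assoc_tmul, LinearMap.lTensor_tmul, TensorProduct.assoc_symm_tmul,
        LinearMap.rTensor_tmul]
      rw [this]
      simp [smul_smul, add_comm, mul_comm]

omit hb [DecidableEq ι] [Fintype ι] in
lemma slice_counit_comul (a : R) :
    sliceRight R (Coalgebra.counit (R := k)) (Coalgebra.comul (R := k) a) = a := by
  simp [sliceRight]

lemma skewDer_mul (i : ι) (a c : R) : hR.skewDer e i (a * c) =
    a * hR.skewDer e i c + hR.skewDer e i a * hR.charHom e hb i c := by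
  simp only [skewDer, LinearMap.comp_apply, hR.comul_mul, hR.slice_braidedTensorMul e hb,
    slice_counit_comul]

omit hb [Fintype ι] in
lemma skewDer_basis (i j : ι) :
    hR.skewDer e i (incl (e j)) = if j = i then 1 else 0 := by
  have h1 := hR.coordOne_of_mem e zero_ne_one i hR.one_mem
  simp [skewDer, (hR.primitive_iff _).2 (hR.incl_mem (e j)), h1, hR.coordOne_incl_basis]

omit hb [DecidableEq ι] [Fintype ι] in
include hR in
lemma comul_ext {n : ℕ} {M : Type*} [AddCommGroup M] [Module k M] {f g : R ⊗[k] R →ₗ[k] M}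
    (h : ∀ p r, p + r = n → ∀ a ∈ 𝒜 p, ∀ c ∈ 𝒜 r, f (a ⊗ₜ c) = g (a ⊗ₜ c)) {a : R}
    (ha : a ∈ 𝒜 n) : f (Coalgebra.comul (R := k) a) = g (Coalgebra.comul (R := k) a) := by
  refine (iSup₂_le fun p hp => ?_ : _ ≤ LinearMap.eqLocus f g) (hR.comul_mem n a ha)
  rintro _ ⟨t, rfl⟩
  have : f ∘ₗ TensorProduct.map (𝒜 p.1).subtype (𝒜 p.2).subtype =
      g ∘ₗ TensorProduct.map (𝒜 p.1).subtype (𝒜 p.2).subtype := by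
    ext a c
    exact h p.1 p.2 hp a a.2 c c.2
  exact LinearMap.congr_fun this t

omit hb [DecidableEq ι] [Fintype ι] in
lemma skewDer_mem (i : ι) {n : ℕ} {a : R} (ha : a ∈ 𝒜 (n + 1)) : hR.skewDer e i a ∈ 𝒜 n := by
  have h := hR.comul_ext (f := sliceRight R (hR.coordOne e i))
    (g := gradedProj hR.isInternal n ∘ₗ sliceRight R (hR.coordOne e i)) (fun p r hpr a ha c hc => by
      simp only [LinearMap.comp_apply, sliceRight_tmul, map_smul]
      by_cases hr : r = 1
      · rw [gradedProj_of_mem hR.isInternal ha, if_pos (by omega)]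
      · rw [hR.coordOne_of_mem e hr i hc, zero_smul, zero_smul]) ha
  simp only [skewDer, LinearMap.comp_apply] at h ⊢
  rw [h]
  exact gradedProj_mem _ _ _

-- Coassociativity: `∂ᵢ` contracts the last leg of the iterated coproduct.
omit hb [DecidableEq ι] [Fintype ι] in
lemma lTensor_skewDer_comul (i : ι) (a : R) :
    (hR.skewDer e i).lTensor R (Coalgebra.comul (R := k) a) =
      Coalgebra.comul (R := k) (hR.skewDer e i a) := by
  have key : ∀ t : R ⊗[k] R, sliceRight (R ⊗[k] R) (hR.coordOne e i)
      ((TensorProduct.assoc k R R R).symm (Coalgebra.comul.lTensor R t)) =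
      (hR.skewDer e i).lTensor R t := by
    intro t
    induction t with
    | zero => simp
    | add s t hs ht => simp only [map_add, hs, ht]
    | tmul a c =>
      simp only [LinearMap.lTensor_tmul, skewDer, LinearMap.comp_apply]
      induction Coalgebra.comul (R := k) c with
      | zero => simp
      | add s t hs ht => simp only [map_add, TensorProduct.tmul_add, hs, ht]
      | tmul s t => simp
  have key2 : ∀ t : R ⊗[k] R, sliceRight (R ⊗[k] R) (hR.coordOne e i)
      (Coalgebra.comul.rTensor R t) =
      Coalgebra.comul (R := k) (sliceRight R (hR.coordOne e i) t) := by
    intro t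
    induction t with
    | zero => simp
    | add s t hs ht => simp only [map_add, hs, ht]
    | tmul a c => simp
  rw [← key, ← Coalgebra.coassoc_apply, LinearEquiv.symm_apply_apply, key2]
  rfl

omit hb [DecidableEq ι] in
/-- An element of positive degree killed by all skew derivations vanishes. -/
lemma eq_zero_of_skewDer_eq_zero {n : ℕ} (hn : n ≠ 0) {a : R} (ha : a ∈ 𝒜 n)
    (h : ∀ i, hR.skewDer e i a = 0) : a = 0 := by
  induction n using Nat.strong_induction_on generalizing a with
  | _ n ih =>
  let π := gradedProj hR.isInternal
  have hπ0 : ∀ c, π 0 c = Coalgebra.counit (R := k) c • (1 : R) := by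
    have : π 0 = (Coalgebra.counit (R := k) (A := R)).smulRight 1 := by
      refine graded_ext hR.isInternal fun m c hc => ?_
      simp only [π, gradedProj_of_mem hR.isInternal hc, LinearMap.smulRight_apply]
      split_ifs with hm
      · subst hm
        rw [hR.zero_eq, Submodule.mem_span_singleton] at hc
        obtain ⟨r, rfl⟩ := hc
        simp [hR.counit_one]
      · rw [hR.counit_eq_zero m hm c hc, zero_smul]
    exact fun c => LinearMap.congr_fun this c
  -- By induction the `∂ᵢ` are jointly injective in degree `m`, so the projection `π m` factors
  -- through them. On the second leg of `Δ(a)` they produce `Δ(∂ᵢ a) = 0`.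
  have hmid : ∀ m, m ≠ 0 → m < n → (π m).lTensor R (Coalgebra.comul (R := k) a) = 0 := by
    intro m hm0 hmn
    obtain ⟨l, rfl⟩ := Nat.exists_eq_succ_of_ne_zero hm0
    let J : 𝒜 (l + 1) →ₗ[k] (ι → R) := LinearMap.pi fun i => hR.skewDer e i ∘ₗ (𝒜 (l + 1)).subtype
    have hJ : LinearMap.ker J = ⊥ := by
      refine LinearMap.ker_eq_bot'.2 fun c hc => ?_
      exact Subtype.ext (ih (l + 1) hmn hm0 c.2 fun i => congrFun hc i)
    obtain ⟨L, hL⟩ := LinearMap.exists_leftInverse_of_injective J hJ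
    have hfac : ∀ i, hR.skewDer e i ∘ₗ π (l + 1) = π l ∘ₗ hR.skewDer e i := by
      intro i
      refine graded_ext hR.isInternal fun p c hc => ?_
      simp only [LinearMap.comp_apply, π, gradedProj_of_mem hR.isInternal hc]
      cases p with
      | zero =>
        rw [if_neg (by omega), map_zero]
        have : hR.skewDer e i c = 0 := by
          rw [hR.zero_eq, Submodule.mem_span_singleton] at hc
          obtain ⟨r, rfl⟩ := hc
          have h1 := hR.coordOne_of_mem e zero_ne_one i hR.one_mem
          simp [skewDer, hR.comul_one, h1]
        rw [this, map_zero]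
      | succ p =>
        rw [gradedProj_of_mem hR.isInternal (hR.skewDer_mem e i hc)]
        by_cases hpl : p = l
        · simp [hpl]
        · simp [hpl]
    classical
    have hsum : π (l + 1) = ∑ i, ((𝒜 (l + 1)).subtype ∘ₗ L ∘ₗ LinearMap.single k (fun _ => R) i ∘ₗ
        π l) ∘ₗ hR.skewDer e i := by
      ext c
      have h1 := LinearMap.congr_fun hL ⟨π (l + 1) c, gradedProj_mem _ _ _⟩
      simp only [LinearMap.comp_apply, LinearMap.id_apply] at h1
      have h2 : J ⟨π (l + 1) c, gradedProj_mem _ _ _⟩ =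
          ∑ i, Pi.single i (π l (hR.skewDer e i c)) := by
        rw [Finset.univ_sum_single]
        funext i
        exact LinearMap.congr_fun (hfac i) c
      rw [h2, map_sum] at h1
      simp only [LinearMap.sum_apply, LinearMap.comp_apply]
      rw [← map_sum]
      exact (congrArg Subtype.val h1).symm
    show (π (l + 1)).lTensor R _ = 0
    rw [← LinearMap.coe_lTensorHom, hsum, map_sum, LinearMap.sum_apply]
    refine Finset.sum_eq_zero fun i _ => ?_
    rw [LinearMap.coe_lTensorHom, LinearMap.lTensor_comp_apply, hR.lTensor_skewDer_comul, h,
      map_zero, map_zero]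
  -- Only the two extreme components of `Δ(a)` remain, and the counit axioms identify them.
  have hprim : Coalgebra.comul (R := k) a = a ⊗ₜ[k] 1 + 1 ⊗ₜ[k] a := by
    have h1 : Coalgebra.comul (R := k) a =
        (∑ m ∈ Finset.range (n + 1), (π m).lTensor R) (Coalgebra.comul (R := k) a) := by
      refine hR.comul_ext (f := LinearMap.id) (fun p r hpr c hc d hd => ?_) ha
      simp only [LinearMap.id_apply, LinearMap.sum_apply, LinearMap.lTensor_tmul, π,
        gradedProj_of_mem hR.isInternal hd, ← TensorProduct.tmul_sum, Finset.sum_ite_eq,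
        Finset.mem_range]
      rw [if_pos (by omega)]
    have h2 : (π n).lTensor R (Coalgebra.comul (R := k) a) =
        (π 0).rTensor R (Coalgebra.comul (R := k) a) := by
      refine hR.comul_ext (fun p r hpr c hc d hd => ?_) ha
      simp only [LinearMap.lTensor_tmul, LinearMap.rTensor_tmul, π,
        gradedProj_of_mem hR.isInternal hd, gradedProj_of_mem hR.isInternal hc]
      by_cases hp : p = 0
      · rw [if_pos (by omega), if_pos hp]
      · rw [if_neg (by omega), if_neg hp, TensorProduct.tmul_zero, TensorProduct.zero_tmul]
    have h3 : (π 0).rTensor R (Coalgebra.comul (R := k) a) = 1 ⊗ₜ a := by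
      have : π 0 = LinearMap.toSpanSingleton k R 1 ∘ₗ Coalgebra.counit (R := k) :=
        LinearMap.ext hπ0
      rw [this, LinearMap.rTensor_comp_apply, Coalgebra.rTensor_counit_comul]
      simp
    have h4 : (π 0).lTensor R (Coalgebra.comul (R := k) a) = a ⊗ₜ 1 := by
      have : π 0 = LinearMap.toSpanSingleton k R 1 ∘ₗ Coalgebra.counit (R := k) :=
        LinearMap.ext hπ0
      rw [this, LinearMap.lTensor_comp_apply, Coalgebra.lTensor_counit_comul]
      simp
    rw [LinearMap.sum_apply, Finset.sum_range_succ, h2, h3,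
      Finset.sum_eq_single_of_mem 0 (by simp; omega), h4] at h1
    · exact h1
    · intro m hm hm0
      exact hmid m hm0 (Finset.mem_range.1 hm)
  have h1 := (hR.primitive_iff a).1 hprim
  have h2 : ∑ i, hR.coordOne e i a • incl (e i) = a := hR.sum_coordOne e h1
  -- On a primitive element, `∂ᵢ` returns the `i`-th coordinate times `1`.
  have h3 : ∀ i, hR.coordOne e i a • (1 : R) = 0 := by
    intro i
    have := h i
    have h10 := hR.coordOne_of_mem e zero_ne_one i hR.one_mem
    simpa [skewDer, hprim, h10] using this
  rw [← h2]
  refine Finset.sum_eq_zero fun i _ => ?_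
  rw [← one_mul (incl (e i)), ← smul_mul_assoc, h3, zero_mul]

end IsNicholsAlgebra

/-! ### `q`-integers and the function `N(q)`. -/

section QNumbers

variable {k : Type*} [Field k]

/-- The `q`-integer `1 + q + ⋯ + q ^ (n - 1)`. -/
def qInt (q : k) (n : ℕ) : k := ∑ i ∈ Finset.range n, q ^ i

lemma qInt_succ (q : k) (n : ℕ) : qInt q (n + 1) = qInt q n + q ^ n := Finset.sum_range_succ _ _

@[simp] lemma qInt_zero (q : k) : qInt q 0 = 0 := Finset.sum_range_zero _

lemma qInt_eq_zero_iff_of_ne_one {q : kˣ} (hq : q ≠ 1) (n : ℕ) :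
    qInt (q : k) n = 0 ↔ q ^ n = 1 := by
  have hq' : (q : k) - 1 ≠ 0 := sub_ne_zero.2 fun h => hq (Units.ext h)
  have := geom_sum_mul (q : k) n
  rw [← mul_left_inj' hq', zero_mul, qInt, this, sub_eq_zero, Units.ext_iff]
  simp

/-- Together with `qInt_eq_zero`, this explains `nicholsN`: it is the first positive zero of `n ↦
(n)_q`, including at `q = 1`, where `(n)_1 = n`. -/
lemma qInt_ne_zero {q : kˣ} {n : ℕ} (hn : 0 < n) (h : (n : ℕ∞) < nicholsN q) :
    qInt (q : k) n ≠ 0 := by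
  unfold nicholsN at h
  split_ifs at h with h1 h2 h3
  · subst h1
    have := ringChar.spec k n
    rw [h2, Nat.zero_dvd] at this
    simpa [qInt] using fun h => hn.ne' (this.1 h)
  · subst h1
    have := ringChar.spec k n
    simp only [qInt, Units.val_one, one_pow, Finset.sum_const, Finset.card_range, nsmul_eq_mul,
      mul_one, Ne, this]
    exact fun hd => (Nat.le_of_dvd hn hd).not_gt (by exact_mod_cast h)
  · rw [Ne, qInt_eq_zero_iff_of_ne_one h1]
    exact pow_ne_one_of_lt_orderOf hn.ne' (by exact_mod_cast h)
  · rw [Ne, qInt_eq_zero_iff_of_ne_one h1]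
    exact fun h' => h3 (isOfFinOrder_iff_pow_eq_one.2 ⟨n, hn, h'⟩)

lemma qInt_eq_zero {q : kˣ} {n : ℕ} (h : nicholsN q = n) : qInt (q : k) n = 0 := by
  unfold nicholsN at h
  split_ifs at h with h1 h2 h3
  · simp at h
  · subst h1
    have : ringChar k = n := by exact_mod_cast h
    simp [qInt, ← this]
  · rw [qInt_eq_zero_iff_of_ne_one h1]
    have : orderOf q = n := by exact_mod_cast h
    rw [← this, pow_orderOf_eq_one]
  · simp at h

lemma nicholsN_of_ne_one {q : kˣ} (hq : q ≠ 1) (h : nicholsN q < ⊤) :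
    0 < orderOf q ∧ nicholsN q = orderOf q := by
  unfold nicholsN at h ⊢
  rw [if_neg hq] at h ⊢
  split_ifs at h ⊢ with h1
  · exact ⟨h1.orderOf_pos, rfl⟩
  · simp at h

lemma nicholsN_ne_zero (q : kˣ) : nicholsN q ≠ 0 := by
  unfold nicholsN
  split_ifs with h1 h2 h3
  · simp
  · exact_mod_cast h2
  · exact_mod_cast h3.orderOf_pos.ne'
  · simp

lemma nicholsN_neg_one (hk : ringChar k ≠ 2) : nicholsN (-1 : kˣ) = 2 := by
  have h1 : (-1 : kˣ) ≠ 1 := fun h => Ring.neg_one_ne_one_of_char_ne_two hk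
    (by simpa using congrArg Units.val h)
  have h2 : orderOf (-1 : kˣ) = 2 := orderOf_eq_prime (by simp) h1
  have h3 : IsOfFinOrder (-1 : kˣ) := orderOf_pos_iff.1 (by omega)
  rw [nicholsN, if_neg h1, if_pos h3, h2]
  rfl

end QNumbers

/-! ### A criterion for linear independence by lowering operators. -/

section Ladder

lemma ENat.toENat_mk_lt (N : ℕ∞) : Cardinal.toENat (Cardinal.mk {n : ℕ // (n : ℕ∞) < N}) = N := by
  induction N with
  | top =>
    rw [Cardinal.toENat_eq_top]
    have : Infinite {n : ℕ // (n : ℕ∞) < ⊤} :=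
      Infinite.of_injective (fun n : ℕ => ⟨n, ENat.natCast_lt_top n⟩) fun m n h => by simpa using h
    exact Cardinal.aleph0_le_mk _
  | coe N =>
    have : {n : ℕ // (n : ℕ∞) < N} ≃ Fin N :=
      (Equiv.subtypeEquivRight fun n => by simp).trans Fin.equivSubtype.symm
    rw [Cardinal.mk_congr this]
    simp

/-- A family which is moved down step by step, up to non-zero scalars, by a linear operator is
linearly independent if its bottom row is. -/
lemma linearIndependent_ladder {k M κ : Type*} [Field k] [AddCommGroup M] [Module k M]
    (δ : M →ₗ[k] M) (v : κ → ℕ → M) (N : ℕ∞) (h0 : ∀ s, δ (v s 0) = 0)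
    (hsucc : ∀ s (n : ℕ), ((n + 1 : ℕ) : ℕ∞) < N → ∃ c : k, c ≠ 0 ∧ δ (v s (n + 1)) = c • v s n)
    (hv : LinearIndependent k fun s => v s 0) :
    LinearIndependent k fun p : κ × {n : ℕ // (n : ℕ∞) < N} => v p.1 p.2 := by
  have hdiag : ∀ n : ℕ, (n : ℕ∞) < N → ∀ s, ∃ c : k, c ≠ 0 ∧ (δ ^ n) (v s n) = c • v s 0 := by
    intro n
    induction n with
    | zero => exact fun _ s => ⟨1, one_ne_zero, by simp⟩
    | succ n ih =>
      intro hn s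
      obtain ⟨c, hc, h⟩ := hsucc s n hn
      obtain ⟨d, hd, h'⟩ := ih (lt_trans (by exact_mod_cast n.lt_succ_self) hn) s
      exact ⟨c * d, mul_ne_zero hc hd, by
        rw [pow_succ, Module.End.mul_apply, h, map_smul, h', smul_smul]⟩
  have hlow : ∀ m n : ℕ, m < n → (m : ℕ∞) < N → ∀ s, (δ ^ n) (v s m) = 0 := by
    intro m n hmn hm s
    obtain ⟨c, hc, h⟩ := hdiag m hm s
    obtain ⟨l, rfl⟩ := Nat.exists_eq_add_of_lt hmn
    rw [show m + l + 1 = l + 1 + m by ring, pow_add, Module.End.mul_apply, h, map_smul, pow_succ,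
      Module.End.mul_apply, h0, map_zero, smul_zero]
  choose! C hC0 hC using hdiag
  rw [linearIndependent_iff]
  intro l hl
  by_contra hne
  -- Applying `δ` as often as the greatest height in the relation kills all lower rows and carries
  -- the top row to nonzero multiples of bottom vectors.
  obtain ⟨p, hp, hmax⟩ := l.support.exists_max_image (fun p => (p.2 : ℕ))
    (Finsupp.support_nonempty_iff.2 hne)
  have key : ∑ r ∈ l.support, (if (r.2 : ℕ) = p.2 then l r * C p.2 r.1 else 0) • v r.1 0 = 0 := by
    have h1 := congrArg (δ ^ (p.2 : ℕ)) hl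
    rw [Finsupp.linearCombination_apply, Finsupp.sum, map_sum, map_zero] at h1
    rw [← h1]
    refine Finset.sum_congr rfl fun r hr => ?_
    rw [map_smul]
    split_ifs with hrp
    · rw [← hrp, hC _ r.2.2, smul_smul]
    · rw [hlow _ _ (lt_of_le_of_ne (hmax r hr) hrp) r.2.2, zero_smul, smul_zero]
  let F : Finset (κ × {n : ℕ // (n : ℕ∞) < N}) := l.support.filter fun r => (r.2 : ℕ) = p.2
  have hinj : Set.InjOn Prod.fst (F : Set (κ × {n : ℕ // (n : ℕ∞) < N})) := by
    intro r hr s hs hrs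
    simp only [F, Finset.coe_filter, Set.mem_ofPred_eq] at hr hs
    exact Prod.ext hrs (Subtype.ext (hr.2.trans hs.2.symm))
  simp only [ite_smul, zero_smul] at key
  rw [← Finset.sum_filter] at key
  have h2 : LinearIndepOn k (fun r : κ × {n : ℕ // (n : ℕ∞) < N} => v r.1 0)
      (F : Set (κ × {n : ℕ // (n : ℕ∞) < N})) :=
    hv.comp (fun r : (F : Set (κ × {n : ℕ // (n : ℕ∞) < N})) => r.1.1)
      (fun r s hrs => Subtype.ext (hinj r.2 s.2 hrs))
  have h3 := linearIndepOn_finset_iff.1 h2 _ key p (by simpa [F] using hp)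
  exact (mul_ne_zero (Finsupp.mem_support_iff.1 hp) (hC0 _ p.2.2 _)) h3

end Ladder

/-! ### Calculus with skew derivations on powers and iterated adjoint actions. -/

/-- Skew derivations `∂ᵢ(a c) = a ∂ᵢ(c) + ∂ᵢ(a) gᵢ(c)` dual to the generators `xᵢ`, twisted by
algebra endomorphisms `gᵢ` which are diagonal on the generators. -/
structure IsSkewDual {k R ι : Type*} [Field k] [Ring R] [Algebra k R] [DecidableEq ι] (x : ι → R)
    (b : ι → ι → kˣ) (g : ι → R →ₐ[k] R) (d : ι → R →ₗ[k] R) : Prop where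
  map_gen : ∀ i j, g i (x j) = (b i j : k) • x j
  der_gen : ∀ i j, d i (x j) = if j = i then 1 else 0
  der_mul : ∀ i a c, d i (a * c) = a * d i c + d i a * g i c

namespace IsSkewDual

variable {k R ι : Type*} [Field k] [Ring R] [Algebra k R] [DecidableEq ι] {x : ι → R}
  {b : ι → ι → kˣ} {g : ι → R →ₐ[k] R} {d : ι → R →ₗ[k] R} (h : IsSkewDual x b g d)
include h

lemma der_one (i : ι) : d i 1 = 0 := by
  have := h.der_mul i 1 1
  simpa using this

lemma der_pow_of_der_eq_zero {i : ι} {a : R} (ha : d i a = 0) (n : ℕ) : d i (a ^ n) = 0 := by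
  induction n with
  | zero => rw [pow_zero, h.der_one]
  | succ n ih => rw [pow_succ, h.der_mul, ih, ha, mul_zero, zero_mul, add_zero]

lemma der_pow_self (i : ι) (n : ℕ) :
    d i (x i ^ (n + 1)) = qInt (b i i : k) (n + 1) • x i ^ n := by
  induction n with
  | zero => simp [h.der_gen, qInt]
  | succ n ih =>
    rw [pow_succ', h.der_mul, ih, h.der_gen, if_pos rfl, one_mul, map_pow, h.map_gen, smul_pow,
      qInt_succ _ (n + 1), add_smul, mul_smul_comm, ← pow_succ']

lemma pow_ne_zero_of_qInt [Nontrivial R] (i : ι) (n : ℕ)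
    (hq : ∀ m, 0 < m → m ≤ n → qInt (b i i : k) m ≠ 0) : x i ^ n ≠ 0 := by
  induction n with
  | zero => simp
  | succ n ih =>
    intro h0
    have h1 := h.der_pow_self i n
    rw [h0, map_zero, eq_comm, smul_eq_zero] at h1
    exact h1.elim (hq _ n.succ_pos le_rfl) (ih fun m hm hmn => hq m hm (by omega))

lemma map_ad_pow {i : ι} {T : R →ₗ[k] R} (hT : ∀ w, T w = x i * w - g i w * x i) (j l : ι)
    (n : ℕ) : g l ((T ^ n) (x j)) = ((b l i : k) ^ n * b l j) • (T ^ n) (x j) := by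
  induction n generalizing l with
  | zero => simp [h.map_gen]
  | succ n ih =>
    rw [pow_succ', Module.End.mul_apply, hT, ih i]
    simp only [map_sub, map_mul, map_smul, ih l, h.map_gen, smul_mul_assoc, mul_smul_comm,
      smul_sub, smul_smul]
    congr 2 <;> ring

/-- With `w` the previous iterate, `∂ᵢ(xᵢw)` and `∂ᵢ(gᵢ(w)xᵢ)` both reduce to `gᵢ(w)`. -/
lemma der_ad_pow_self {i j : ι} (hij : i ≠ j) {T : R →ₗ[k] R}
    (hT : ∀ w, T w = x i * w - g i w * x i) (n : ℕ) : d i ((T ^ n) (x j)) = 0 := by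
  induction n with
  | zero => simp [h.der_gen, hij.symm]
  | succ n ih =>
    rw [pow_succ', Module.End.mul_apply, hT, map_sub, h.der_mul, h.map_ad_pow hT, h.der_mul,
      map_smul, ih, h.der_gen]
    simp

/-- On the `n`-th iterate `w`, `gᵢ` is the scalar `bᵢᵢⁿbᵢⱼ`, and `gⱼ(xᵢ) = bⱼᵢxᵢ`. As `∂ⱼ(w)` is a
multiple of `xᵢⁿ`, the next step contributes the factor `1 - bᵢⱼbⱼᵢbᵢᵢⁿ`. -/
lemma der_ad_pow {i j : ι} (hij : i ≠ j) {T : R →ₗ[k] R}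
    (hT : ∀ w, T w = x i * w - g i w * x i) (n : ℕ) : d j ((T ^ n) (x j)) =
      (∏ m ∈ Finset.range n, (1 - (b i j * b j i * b i i ^ m : k))) • x i ^ n := by
  induction n with
  | zero => simp [h.der_gen]
  | succ n ih =>
    rw [pow_succ', Module.End.mul_apply, hT, map_sub, h.der_mul, h.map_ad_pow hT j j,
      h.map_ad_pow hT j i, h.der_mul, map_smul, ih, h.der_gen, if_neg hij, h.map_gen, Finset.prod_range_succ]
    simp only [zero_mul, add_zero, mul_zero, zero_add, smul_zero, smul_mul_assoc, mul_smul_comm, smul_smul,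
      ← pow_succ, ← pow_succ', ← sub_smul]
    congr 1
    ring

end IsSkewDual

/-! ### Rank two: nilpotency of the adjoint action, independence of monomials. -/

section RankTwo

variable {k R : Type*} [Field k] [Ring R] [Algebra k R] {x : Fin 2 → R}
  {b : Fin 2 → Fin 2 → kˣ} {g : Fin 2 → R →ₐ[k] R} {d : Fin 2 → R →ₗ[k] R} {𝒜 : ℕ → Submodule k R}

/-- The least exponent with `(Ad xᵢ)ⁿ(xⱼ) = 0`. -/
lemma exists_isLeast_ad_pow [Nontrivial R] (h : IsSkewDual x b g d)
    (hmul : ∀ m n, ∀ a ∈ 𝒜 m, ∀ c ∈ 𝒜 n, a * c ∈ 𝒜 (m + n)) (hx : ∀ i, x i ∈ 𝒜 1)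
    (hker : ∀ n, n ≠ 0 → ∀ a ∈ 𝒜 n, (∀ i, d i a = 0) → a = 0)
    {i j : Fin 2} (hij : i ≠ j) {T : R →ₗ[k] R} (hT : ∀ w, T w = x i * w - g i w * x i)
    (hb : b i i ≠ 1) (hN : nicholsN (b i i) < ⊤) :
    ∃ n₀ : ℕ, IsLeast {n : ℕ | 0 < n ∧ (T ^ n) (x j) = 0} n₀ ∧ (n₀ : ℕ∞) ≤ nicholsN (b i i) ∧
      ∀ m₀ : ℕ, IsLeast {m : ℕ | b i j * b j i * b i i ^ m = 1} m₀ → n₀ = m₀ + 1 := by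
  obtain ⟨hpos, hord⟩ := nicholsN_of_ne_one hb hN
  have hTmem : ∀ n, (T ^ n) (x j) ∈ 𝒜 (n + 1) := by
    intro n
    induction n with
    | zero => exact hx j
    | succ n ih =>
      rw [pow_succ', Module.End.mul_apply, hT, h.map_ad_pow hT, smul_mul_assoc]
      refine sub_mem ?_ (Submodule.smul_mem _ _ (hmul _ _ _ ih _ (hx i)))
      rw [add_comm (n + 1)]
      exact hmul _ _ _ (hx i) _ ih
  have hxmem : ∀ n, x i ^ (n + 1) ∈ 𝒜 (n + 1) := by
    intro n
    induction n with
    | zero => simpa using hx i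
    | succ n ih => rw [pow_succ]; exact hmul _ _ _ ih _ (hx i)
  have hall : ∀ a, d i a = 0 → d j a = 0 → ∀ l, d l a = 0 := by
    intro a hi hj l
    rcases (by omega : l = i ∨ l = j) with rfl | rfl <;> assumption
  have hTzero : ∀ n, d j ((T ^ n) (x j)) = 0 → (T ^ n) (x j) = 0 := fun n hn =>
    hker _ n.succ_ne_zero _ (hTmem n) (hall _ (h.der_ad_pow_self hij hT n) hn)
  have hxN : x i ^ orderOf (b i i) = 0 := by
    obtain ⟨N, hN'⟩ := Nat.exists_eq_succ_of_ne_zero hpos.ne'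
    rw [Nat.succ_eq_add_one] at hN'
    rw [hN']
    refine hker _ N.succ_ne_zero _ (hxmem N) (hall _ ?_ ?_)
    · rw [h.der_pow_self, ← hN', qInt_eq_zero hord, zero_smul]
    · exact h.der_pow_of_der_eq_zero (by rw [h.der_gen, if_neg hij]) _
  have hex : ∃ n, 0 < n ∧ (T ^ n) (x j) = 0 :=
    ⟨_, hpos, hTzero _ (by rw [h.der_ad_pow hij hT, hxN, smul_zero])⟩
  classical
  have hleast : IsLeast {n : ℕ | 0 < n ∧ (T ^ n) (x j) = 0} (Nat.find hex) :=
    ⟨Nat.find_spec hex, fun n hn => Nat.find_min' hex hn⟩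
  refine ⟨Nat.find hex, hleast, ?_, fun m hm => ?_⟩
  · rw [hord]
    exact_mod_cast hleast.2 ⟨hpos, hTzero _ (by rw [h.der_ad_pow hij hT, hxN, smul_zero])⟩
  · refine hleast.unique ⟨⟨m.succ_pos, hTzero _ ?_⟩, fun n hn => ?_⟩
    · have := congrArg Units.val hm.1
      push_cast at this
      rw [h.der_ad_pow hij hT, Finset.prod_range_succ, this, sub_self, mul_zero, zero_smul]
    -- Here `n ≤ m`. Reducing exponents modulo the order gives `m < orderOf (b i i)`, so `xᵢⁿ ≠ 0`;
    -- a vanishing factor of the product would contradict the minimality of `m`.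
    · by_contra hlt
      have hmN : m < orderOf (b i i) := by
        refine lt_of_le_of_lt (hm.2 (?_ : _ = _)) (Nat.mod_lt m hpos)
        rw [pow_mod_orderOf]
        exact hm.1
      have h1 := h.der_ad_pow hij hT n
      rw [hn.2, map_zero, eq_comm, smul_eq_zero, Finset.prod_eq_zero_iff] at h1
      rcases h1 with ⟨l, hl, h1⟩ | h1
      · rw [sub_eq_zero] at h1
        have := hm.2 (show b i j * b j i * b i i ^ l = 1 from Units.ext (by push_cast; exact h1.symm))
        have := Finset.mem_range.1 hl
        omega
      · refine h.pow_ne_zero_of_qInt i n (fun l hl hln => qInt_ne_zero hl ?_) h1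
        rw [hord]
        have : l < orderOf (b i i) := by omega
        exact_mod_cast this

section Commutator

variable (h : IsSkewDual x b g d) {z : R} (hz : z = x 0 * x 1 - (b 0 1 : k) • (x 1 * x 0))
include h hz

lemma map_commutator (i : Fin 2) : g i z = ((b i 0 : k) * b i 1) • z := by
  rw [hz]
  simp only [map_sub, map_mul, map_smul, h.map_gen, smul_mul_assoc, mul_smul_comm, smul_sub,
    smul_smul]
  congr 2 <;> ring

lemma der_zero_commutator : d 0 z = 0 := by
  rw [hz, map_sub, map_smul, h.der_mul, h.der_mul]
  simp [h.der_gen, h.map_gen]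

lemma der_one_commutator : d 1 z = (1 - (b 0 1 : k) * b 1 0) • x 0 := by
  rw [hz, map_sub, map_smul, h.der_mul, h.der_mul]
  simp [h.der_gen, h.map_gen, smul_smul, sub_smul]

/-- Since `∂₀z = 0` and `∂₀∂₁z` is a scalar, `∂₀∂₁` behaves on powers of `z` like a single skew
derivation twisted by `g₀g₁`, whose eigenvalue on `z` is `q`. -/
lemma der_der_commutator_pow (n : ℕ) : d 0 (d 1 (z ^ (n + 1))) =
    ((1 - (b 0 1 : k) * b 1 0) * qInt (b 0 0 * b 0 1 * b 1 0 * b 1 1 : k) (n + 1)) • z ^ n := by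
  have hd := der_zero_commutator h hz
  induction n with
  | zero => simp [der_one_commutator h hz, h.der_gen, qInt]
  | succ n ih =>
    rw [pow_succ' z (n + 1), h.der_mul, map_add, h.der_mul, hd, zero_mul, add_zero, ih,
      der_one_commutator h hz, map_pow, map_commutator h hz, h.der_mul, smul_pow, map_smul,
      h.der_pow_of_der_eq_zero hd, map_smul, h.der_gen, if_pos rfl, map_smul, map_pow,
      map_commutator h hz, qInt_succ _ (n + 1)]
    simp only [smul_pow, smul_zero, mul_zero, zero_add, mul_smul_comm, smul_mul_assoc, one_mul,
      ← pow_succ', smul_smul, ← add_smul]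
    congr 1
    ring

lemma der_der_pow_mul_commutator_pow (m n : ℕ) : d 0 (d 1 (x 1 ^ m * z ^ n)) =
    x 1 ^ m * d 0 (d 1 (z ^ n)) := by
  have hd := h.der_pow_of_der_eq_zero (der_zero_commutator h hz) n
  have hx : ∀ m, d 0 (x 1 ^ m) = 0 := h.der_pow_of_der_eq_zero (by simp [h.der_gen])
  have hx' : d 0 (d 1 (x 1 ^ m)) = 0 := by
    cases m with
    | zero => simp [h.der_one]
    | succ m => rw [h.der_pow_self, map_smul, hx, smul_zero]
  rw [h.der_mul, map_add, h.der_mul, h.der_mul, hx, hx', map_pow (g 1), map_commutator h hz,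
    smul_pow, map_smul, hd]
  simp

/-- The monomials `xᵃ yᵇ zᶜ` in the range given by `nicholsN` are linearly independent. -/
lemma linearIndependent_monomials [Nontrivial R] (hb : b 0 1 * b 1 0 ≠ 1) {q : kˣ}
    (hq : q = b 0 0 * b 0 1 * b 1 0 * b 1 1) :
    LinearIndependent k fun p : ({n : ℕ // (n : ℕ∞) < nicholsN (b 1 1)} ×
        {n : ℕ // (n : ℕ∞) < nicholsN q}) × {n : ℕ // (n : ℕ∞) < nicholsN (b 0 0)} =>
      x 0 ^ (p.2 : ℕ) * x 1 ^ (p.1.1 : ℕ) * z ^ (p.1.2 : ℕ) := by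
  have hq' : (b 0 0 * b 0 1 * b 1 0 * b 1 1 : k) = q := by rw [hq]; push_cast; rfl
  have hc : (1 - (b 0 1 : k) * b 1 0) ≠ 0 := by
    intro h0
    exact hb (Units.ext (by push_cast; exact (sub_eq_zero.1 h0).symm))
  have hd := der_zero_commutator h hz
  have hx : ∀ m, d 0 (x 1 ^ m) = 0 := h.der_pow_of_der_eq_zero (by simp [h.der_gen])
  have hxz : ∀ m n, d 0 (x 1 ^ m * z ^ n) = 0 := fun m n => by
    rw [h.der_mul, hx, h.der_pow_of_der_eq_zero hd, mul_zero, zero_mul, add_zero]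
  -- Three ladders, adjoining powers of `y`, `z` and `x` in turn; each uses the previous family as
  -- its bottom row.
  have h1 : LinearIndependent k
      fun p : {n : ℕ // (n : ℕ∞) < nicholsN (b 1 1)} => x 1 ^ (p : ℕ) := by
    have := linearIndependent_ladder (d 1) (fun (_ : Unit) n => x 1 ^ n) (nicholsN (b 1 1))
      (fun _ => by simp [h.der_one])
      (fun _ n hn => ⟨_, qInt_ne_zero n.succ_pos hn, h.der_pow_self 1 n⟩)
      (by simp)
    exact this.comp (fun p => ((), p)) fun p r hpr => (Prod.ext_iff.1 hpr).2
  have h2 := linearIndependent_ladder (d 0 ∘ₗ d 1)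
    (fun (p : {n : ℕ // (n : ℕ∞) < nicholsN (b 1 1)}) n => x 1 ^ (p : ℕ) * z ^ n) (nicholsN q)
    (fun p => by
      rw [LinearMap.comp_apply, der_der_pow_mul_commutator_pow h hz, pow_zero, h.der_one, map_zero,
        mul_zero])
    (fun p n hn => ⟨_, mul_ne_zero hc (qInt_ne_zero n.succ_pos hn), by
      rw [LinearMap.comp_apply, der_der_pow_mul_commutator_pow h hz, der_der_commutator_pow h hz,
        hq', mul_smul_comm]⟩)
    (by simpa using h1)
  have h3 := linearIndependent_ladder (d 0)
    (fun (p : {n : ℕ // (n : ℕ∞) < nicholsN (b 1 1)} × {n : ℕ // (n : ℕ∞) < nicholsN q}) n =>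
      x 0 ^ n * (x 1 ^ (p.1 : ℕ) * z ^ (p.2 : ℕ))) (nicholsN (b 0 0))
    (fun p => by simpa using hxz _ _)
    -- The extra scalar is the eigenvalue of `g₀` on `yᵇzᶜ`.
    (fun p n hn => ⟨qInt (b 0 0 : k) (n + 1) *
      ((b 0 1 : k) ^ (p.1 : ℕ) * ((b 0 0 : k) * b 0 1) ^ (p.2 : ℕ)),
      mul_ne_zero (qInt_ne_zero n.succ_pos hn) (by simp), by
      rw [h.der_mul, hxz, mul_zero, zero_add, h.der_pow_self, map_mul, map_pow, map_pow, h.map_gen,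
        map_commutator h hz]
      simp only [smul_pow, smul_mul_assoc, mul_smul_comm, smul_smul]
      congr 1
      ring⟩)
    (by simpa using h2)
  simpa only [mul_assoc] using h3

lemma le_rank [Nontrivial R] (hb : b 0 1 * b 1 0 ≠ 1) {q : kˣ} (hq : q = b 0 0 * b 0 1 * b 1 0 * b 1 1) :
    nicholsN (b 0 0) * nicholsN (b 1 1) * nicholsN q ≤ Cardinal.toENat (Module.rank k R) := by
  have h1 := (linearIndependent_monomials h hz hb hq).cardinal_lift_le_rank
  have h2 := OrderHomClass.mono Cardinal.toENat h1
  simp only [Cardinal.toENat_lift, Cardinal.mk_prod, Cardinal.lift_id, map_mul,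
    ENat.toENat_mk_lt] at h2
  calc _ = _ := by ring
    _ ≤ _ := h2

lemma commutator_pow_ne_zero [Nontrivial R] (hb : b 0 1 * b 1 0 ≠ 1) {q : kˣ}
    (hq : q = b 0 0 * b 0 1 * b 1 0 * b 1 1) {n : ℕ} (hn : (n : ℕ∞) < nicholsN q) : z ^ n ≠ 0 := by
  have := (linearIndependent_monomials h hz hb hq).ne_zero
    ((⟨0, pos_iff_ne_zero.2 (nicholsN_ne_zero _)⟩, ⟨n, hn⟩),
      ⟨0, pos_iff_ne_zero.2 (nicholsN_ne_zero _)⟩)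
  simpa using this

end Commutator

end RankTwo

/-! ### The case `b₁₁ = b₂₂ = -1`. -/

section NegOne

variable {k R : Type*} [Field k] [Ring R] [Algebra k R] {x : Fin 2 → R}
  {b : Fin 2 → Fin 2 → kˣ} {g : Fin 2 → R →ₐ[k] R} {d : Fin 2 → R →ₗ[k] R} {𝒜 : ℕ → Submodule k R}
  (h : IsSkewDual x b g d) (hmul : ∀ m n, ∀ a ∈ 𝒜 m, ∀ c ∈ 𝒜 n, a * c ∈ 𝒜 (m + n))
  (hx : ∀ i, x i ∈ 𝒜 1) (hker : ∀ n, n ≠ 0 → ∀ a ∈ 𝒜 n, (∀ i, d i a = 0) → a = 0)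

include h hmul hx hker in
lemma mul_self_eq_zero_of_neg_one {i : Fin 2} (hb : b i i = -1) : x i * x i = 0 := by
  refine hker 2 two_ne_zero _ (hmul 1 1 _ (hx i) _ (hx i)) fun l => ?_
  rw [h.der_mul, h.map_gen, h.der_gen]
  split_ifs with hl
  · subst hl
    simp [hb]
  · simp

variable {z : R} (hz : z = x 0 * x 1 - (b 0 1 : k) • (x 1 * x 0))

include hz in
lemma gen_zero_mul_commutator (h0 : x 0 * x 0 = 0) : x 0 * z = -(b 0 1 : k) • (z * x 0) := by
  have h1 : x 1 * x 0 * x 0 = 0 := by rw [mul_assoc, h0, mul_zero]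
  have h2 : x 0 * (x 0 * x 1) = 0 := by rw [← mul_assoc, h0, zero_mul]
  rw [hz, mul_sub, sub_mul, h2, mul_smul_comm, smul_mul_assoc, h1]
  simp [mul_assoc]

include hz in
lemma commutator_mul_gen_one (h1 : x 1 * x 1 = 0) : z * x 1 = -(b 0 1 : k) • (x 1 * z) := by
  have h2 : x 0 * x 1 * x 1 = 0 := by rw [mul_assoc, h1, mul_zero]
  have h3 : x 1 * (x 1 * x 0) = 0 := by rw [← mul_assoc, h1, zero_mul]
  rw [hz, mul_sub, sub_mul, h2, mul_smul_comm, smul_mul_assoc, h3]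
  simp [mul_assoc]

-- Moving `x₀` past `zⁿ` costs `(-b₀₁)ⁿ`, and `g₁` contributes `(-b₁₀)ⁿ`; together they give `qⁿ`.
include h hz in
lemma der_one_commutator_pow_of_neg_one (h0 : x 0 * x 0 = 0) (hb0 : b 0 0 = -1) (hb1 : b 1 1 = -1)
    (n : ℕ) : d 1 (z ^ (n + 1)) = ((1 - (b 0 1 : k) * b 1 0) *
      qInt (b 0 0 * b 0 1 * b 1 0 * b 1 1 : k) (n + 1)) • (z ^ n * x 0) := by
  have hcomm : ∀ n, x 0 * z ^ n = (-(b 0 1 : k)) ^ n • (z ^ n * x 0) := by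
    intro n
    induction n with
    | zero => simp
    | succ n ih =>
      rw [pow_succ, ← mul_assoc, ih, smul_mul_assoc, mul_assoc, gen_zero_mul_commutator hz h0,
        mul_smul_comm, smul_smul, ← pow_succ, mul_assoc]
  induction n with
  | zero => simp [der_one_commutator h hz, qInt]
  | succ n ih =>
    rw [pow_succ' z (n + 1), h.der_mul, ih, der_one_commutator h hz, map_pow, map_commutator h hz,
      qInt_succ _ (n + 1), smul_pow, smul_mul_assoc, mul_smul_comm, mul_smul_comm, hcomm,
      ← mul_assoc, ← pow_succ', smul_smul, smul_smul, ← add_smul, hb0, hb1]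
    congr 1
    push_cast
    rw [mul_add, mul_assoc _ (_ ^ _), ← mul_pow]
    congr 3
    ring

include h hmul hx hker hz in
lemma commutator_pow_eq_zero (hb0 : b 0 0 = -1) (hb1 : b 1 1 = -1) {q : kˣ}
    (hq : q = b 0 0 * b 0 1 * b 1 0 * b 1 1) {n : ℕ} (hn : nicholsN q ≤ n) : z ^ n = 0 := by
  have hq' : (b 0 0 * b 0 1 * b 1 0 * b 1 1 : k) = q := by rw [hq]; push_cast; rfl
  obtain ⟨N, hN⟩ := ENat.ne_top_iff_exists.1 (ne_top_of_le_ne_top (ENat.natCast_ne_top n) hn)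
  have hN0 : N ≠ 0 := by
    rintro rfl
    exact nicholsN_ne_zero q hN.symm
  have h0 := mul_self_eq_zero_of_neg_one h hmul hx hker hb0
  obtain ⟨l, rfl⟩ := Nat.exists_eq_succ_of_ne_zero hN0
  have hz1 : z ∈ 𝒜 2 := by
    rw [hz]
    exact sub_mem (hmul 1 1 _ (hx 0) _ (hx 1)) (Submodule.smul_mem _ _ (hmul 1 1 _ (hx 1) _ (hx 0)))
  have hzmem : ∀ n, z ^ (n + 1) ∈ 𝒜 (2 * (n + 1)) := by
    intro n
    induction n with
    | zero => simpa using hz1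
    | succ n ih => rw [pow_succ]; exact hmul _ _ _ ih _ hz1
  -- `∂₀` always kills powers of `z`, and at exponent `N(q) = l + 1` the coefficient in `∂₁` is
  -- `(N)_q = 0`.
  have hzero : z ^ (l + 1) = 0 := by
    refine hker _ (by omega) _ (hzmem l) fun i => ?_
    fin_cases i
    · exact h.der_pow_of_der_eq_zero (der_zero_commutator h hz) _
    · rw [Fin.mk_one, der_one_commutator_pow_of_neg_one h hz h0 hb0 hb1, hq',
        qInt_eq_zero hN.symm, mul_zero, zero_smul]
  rw [← hN] at hn
  exact pow_eq_zero_of_le (by exact_mod_cast hn) hzero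

-- The span is stable under left multiplication by both generators: `yx` is rewritten through `xy`
-- and `z`, and `z` skew-commutes with `y`. It contains `1`, so it is everything.
include hz in
lemma span_monomials_eq_top (hgen : Algebra.adjoin k (Set.range x) = ⊤) (h0 : x 0 * x 0 = 0)
    (h1 : x 1 * x 1 = 0) :
    Submodule.span k (Set.range fun p : ℕ × ℕ × ℕ => x 0 ^ p.1 * x 1 ^ p.2.1 * z ^ p.2.2) = ⊤ := by
  set W := Submodule.span k
    (Set.range fun p : ℕ × ℕ × ℕ => x 0 ^ p.1 * x 1 ^ p.2.1 * z ^ p.2.2)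
  have hmem : ∀ a c e : ℕ, x 0 ^ a * x 1 ^ c * z ^ e ∈ W := fun a c e =>
    Submodule.subset_span ⟨(a, c, e), rfl⟩
  have hleft : ∀ r : R, (∀ a c e : ℕ, r * (x 0 ^ a * x 1 ^ c * z ^ e) ∈ W) → ∀ w ∈ W, r * w ∈ W := by
    intro r hr w hw
    have : W ≤ W.comap (LinearMap.mulLeft k r) := by
      rw [Submodule.span_le]
      rintro _ ⟨p, rfl⟩
      exact hr _ _ _
    exact this hw
  have hx0 : ∀ w ∈ W, x 0 * w ∈ W := hleft _ fun a c e => by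
    rw [← mul_assoc, ← mul_assoc, ← pow_succ']
    exact hmem _ _ _
  have hzx : ∀ c, z * x 1 ^ c = (-(b 0 1 : k)) ^ c • (x 1 ^ c * z) := by
    intro c
    induction c with
    | zero => simp
    | succ c ih =>
      rw [pow_succ, ← mul_assoc, ih, smul_mul_assoc, mul_assoc, commutator_mul_gen_one hz h1,
        mul_smul_comm, smul_smul, ← pow_succ, mul_assoc]
  have hyx : x 1 * x 0 = (b 0 1 : k)⁻¹ • (x 0 * x 1 - z) := by
    rw [hz, sub_sub_cancel, smul_smul, inv_mul_cancel₀ (Units.ne_zero _), one_smul]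
  have hx1 : ∀ w ∈ W, x 1 * w ∈ W := hleft _ fun a c e => by
    match a with
    | 0 =>
      rw [pow_zero, one_mul, ← mul_assoc, ← pow_succ']
      simpa using hmem 0 (c + 1) e
    | 1 =>
      rw [pow_one, ← mul_assoc, ← mul_assoc, hyx, smul_mul_assoc, smul_mul_assoc, sub_mul,
        mul_assoc (x 0), ← pow_succ', hzx, sub_mul, smul_mul_assoc, mul_assoc _ z, ← pow_succ']
      refine W.smul_mem _ (W.sub_mem ?_ (W.smul_mem _ ?_))
      · simpa using hmem 1 (c + 1) e
      · simpa using hmem 0 c (e + 1)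
    | a + 2 =>
      rw [pow_add, pow_two, h0]
      simp
  rw [eq_top_iff]
  intro r hr
  rw [← Algebra.top_toSubmodule, ← hgen, Subalgebra.mem_toSubmodule] at hr
  have key : ∀ w ∈ W, r * w ∈ W := by
    induction hr using Algebra.adjoin_induction with
    | mem a ha =>
      obtain ⟨i, rfl⟩ := ha
      fin_cases i
      · exact hx0
      · exact hx1
    | algebraMap c =>
      intro w hw
      rw [← Algebra.smul_def]
      exact W.smul_mem _ hw
    | add a c _ _ ha hc =>
      intro w hw
      rw [add_mul]
      exact W.add_mem (ha w hw) (hc w hw)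
    | mul a c _ _ ha hc =>
      intro w hw
      rw [mul_assoc]
      exact ha _ (hc w hw)
  simpa using key 1 (by simpa using hmem 0 0 0)

include h hmul hx hker hz in
/-- The monomial basis in the case `b₁₁ = b₂₂ = -1`. -/
lemma exists_basis_of_neg_one [Nontrivial R] (hk : ringChar k ≠ 2)
    (hgen : Algebra.adjoin k (Set.range x) = ⊤) (hb : b 0 1 * b 1 0 ≠ 1)
    (hb0 : b 0 0 = -1) (hb1 : b 1 1 = -1) {q : kˣ} (hq : q = b 0 0 * b 0 1 * b 1 0 * b 1 1) :
    ∃ B : Module.Basis {t : Fin 2 × Fin 2 × ℕ // (t.2.2 : ℕ∞) < nicholsN q} k R,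
      ∀ t, B t = x 0 ^ (t.1.1 : ℕ) * x 1 ^ (t.1.2.1 : ℕ) * z ^ t.1.2.2 := by
  have h0 := mul_self_eq_zero_of_neg_one h hmul hx hker hb0
  have h1 := mul_self_eq_zero_of_neg_one h hmul hx hker hb1
  have hlt : ∀ (c : kˣ), c = -1 → ∀ a : Fin 2, ((a : ℕ) : ℕ∞) < nicholsN c := by
    rintro _ rfl a
    rw [nicholsN_neg_one hk]
    exact_mod_cast a.2
  have hli : LinearIndependent k
      fun t : {t : Fin 2 × Fin 2 × ℕ // (t.2.2 : ℕ∞) < nicholsN q} =>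
        x 0 ^ (t.1.1 : ℕ) * x 1 ^ (t.1.2.1 : ℕ) * z ^ t.1.2.2 := by
    let f : {t : Fin 2 × Fin 2 × ℕ // (t.2.2 : ℕ∞) < nicholsN q} →
        ({n : ℕ // (n : ℕ∞) < nicholsN (b 1 1)} × {n : ℕ // (n : ℕ∞) < nicholsN q}) ×
          {n : ℕ // (n : ℕ∞) < nicholsN (b 0 0)} :=
      fun t => ((⟨t.1.2.1, hlt _ hb1 _⟩, ⟨t.1.2.2, t.2⟩), ⟨t.1.1, hlt _ hb0 _⟩)
    have hf : Function.Injective f := by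
      rintro ⟨⟨a, c, e⟩, _⟩ ⟨⟨a', c', e'⟩, _⟩ heq
      simp only [f, Prod.mk.injEq, Subtype.mk.injEq, Fin.val_inj] at heq ⊢
      tauto
    exact (linearIndependent_monomials h hz hb hq).comp f hf
  refine ⟨Module.Basis.mk hli ?_, fun t => by rw [Module.Basis.mk_apply]⟩
  rw [← span_monomials_eq_top hz hgen h0 h1, Submodule.span_le]
  rintro _ ⟨⟨a, c, e⟩, rfl⟩
  -- Monomials with an exponent out of range are zero.
  by_cases ha : a < 2
  · by_cases hc : c < 2
    · by_cases he : (e : ℕ∞) < nicholsN q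
      · exact Submodule.subset_span ⟨⟨(⟨a, ha⟩, ⟨c, hc⟩, e), he⟩, rfl⟩
      · simp [commutator_pow_eq_zero h hmul hx hker hz hb0 hb1 hq (not_lt.1 he)]
    · have : x 1 ^ c = 0 := pow_eq_zero_of_le (not_lt.1 hc) (by rw [pow_two, h1])
      simp [this]
  · have : x 0 ^ a = 0 := pow_eq_zero_of_le (not_lt.1 ha) (by rw [pow_two, h0])
    simp [this]

lemma toENat_rank_of_basis {N : ℕ∞}
    (B : Module.Basis {t : Fin 2 × Fin 2 × ℕ // (t.2.2 : ℕ∞) < N} k R) :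
    Cardinal.toENat (Module.rank k R) = 4 * N := by
  let f : {t : Fin 2 × Fin 2 × ℕ // (t.2.2 : ℕ∞) < N} ≃ (Fin 2 × Fin 2) × {n : ℕ // (n : ℕ∞) < N} :=
    { toFun := fun t => ((t.1.1, t.1.2.1), ⟨t.1.2.2, t.2⟩)
      invFun := fun p => ⟨(p.1.1, p.1.2, p.2), p.2.2⟩
      left_inv := fun _ => rfl
      right_inv := fun _ => rfl }
  have h1 := congrArg Cardinal.toENat (B.reindex f).mk_eq_rank
  simp only [Cardinal.toENat_lift, Cardinal.mk_prod, Cardinal.lift_id, Cardinal.lift_uzero, map_mul,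
    ENat.toENat_mk_lt] at h1
  rw [← h1]
  norm_num

end NegOne
-- Assembly: passage to `IsSkewDual` and the three parts.
theorem mainTheorem3 {k : Type*} [Field k] [IsAlgClosed k] (hk : ringChar k ≠ 2)
    {H : Type*} [Ring H] [HopfAlgebra k H]
    {V : Type*} [AddCommGroup V] [Module k V]
    (DV : YDData k H V) (hDV : DV.IsYetterDrinfeld)
    (e : Module.Basis (Fin 2) k V) (b : Fin 2 → Fin 2 → kˣ) (hb : DV.HasMatrix e b)
    (hb12 : b 0 1 * b 1 0 ≠ 1) (hb1 : b 0 0 ≠ 1) (hb2 : b 1 1 ≠ 1)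
    (hN1 : nicholsN (b 0 0) < ⊤) (hN2 : nicholsN (b 1 1) < ⊤)
    {R : Type*} [Ring R] [Algebra k R] [Coalgebra k R]
    (D : YDData k H R) (S : R →ₗ[k] R) (𝒜 : ℕ → Submodule k R) (incl : V →ₗ[k] R)
    (hR : IsNicholsAlgebra DV D S 𝒜 incl)
    (x y z : R) (hx : x = incl (e 0)) (hy : y = incl (e 1)) (hz : z = braidedAd D S x y)
    (q : kˣ) (hq : q = b 0 0 * b 0 1 * b 1 0 * b 1 1) :
    z = x * y - (b 0 1 : k) • (y * x) ∧
    -- part 1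
    (∃ n₁₂ : ℕ, IsLeast {n : ℕ | 0 < n ∧ ((braidedAd D S x) ^ n) y = 0} n₁₂ ∧
      (n₁₂ : ℕ∞) ≤ nicholsN (b 0 0) ∧
      ∀ m₁₂ : ℕ, IsLeast {m : ℕ | b 0 1 * b 1 0 * b 0 0 ^ m = 1} m₁₂ → n₁₂ = m₁₂ + 1) ∧
    (∃ n₂₁ : ℕ, IsLeast {n : ℕ | 0 < n ∧ ((braidedAd D S y) ^ n) x = 0} n₂₁ ∧
      (n₂₁ : ℕ∞) ≤ nicholsN (b 1 1) ∧
      ∀ m₂₁ : ℕ, IsLeast {m : ℕ | b 0 1 * b 1 0 * b 1 1 ^ m = 1} m₂₁ → n₂₁ = m₂₁ + 1) ∧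
    -- part 2
    (q = 1 → ringChar k = 0 → (∀ n : ℕ, z ^ n ≠ 0) ∧ ¬ FiniteDimensional k R) ∧
    (q = 1 → ringChar k ≠ 0 →
      nicholsN (b 0 0) * nicholsN (b 1 1) * (ringChar k : ℕ∞) ≤
        Cardinal.toENat (Module.rank k R)) ∧
    -- part 3
    (b 0 0 = -1 → b 1 1 = -1 →
      Cardinal.toENat (Module.rank k R) = 4 * nicholsN q ∧
      ∃ B : Module.Basis {t : Fin 2 × Fin 2 × ℕ // (t.2.2 : ℕ∞) < nicholsN q} k R,
        ∀ t, B t = x ^ (t.1.1 : ℕ) * y ^ (t.1.2.1 : ℕ) * z ^ t.1.2.2) := by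
  subst hx hy
  have hinj := hR.incl_injective
  have hnt : Nontrivial R := ⟨⟨incl (e 0), 0, fun h0 => e.ne_zero 0 (hinj (by rw [h0, map_zero]))⟩⟩
  have h : IsSkewDual (fun i => incl (e i)) b (hR.charHom e hb) (hR.skewDer e) :=
    ⟨hR.charHom_basis e hb, hR.skewDer_basis e, hR.skewDer_mul e hb⟩
  have hx : ∀ i, incl (e i) ∈ 𝒜 1 := fun i => hR.incl_mem _
  have hker : ∀ n, n ≠ 0 → ∀ a ∈ 𝒜 n, (∀ i, hR.skewDer e i a = 0) → a = 0 :=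
    fun n hn a ha => hR.eq_zero_of_skewDer_eq_zero e hn ha
  have hgen : Algebra.adjoin k (Set.range fun i => incl (e i)) = ⊤ := by
    rw [eq_top_iff, ← hR.adjoin_eq_top]
    refine Algebra.adjoin_le fun a ha => ?_
    rw [← hR.sum_coordOne e ha]
    exact sum_mem fun i _ => Subalgebra.smul_mem _ (Algebra.subset_adjoin (Set.mem_range_self i)) _
  have hz' : z = incl (e 0) * incl (e 1) - (b 0 1 : k) • (incl (e 1) * incl (e 0)) := by
    rw [hz, hR.braidedAd_basis e hb, hR.charHom_basis, smul_mul_assoc]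
  have hrank := le_rank h hz' hb12 hq
  refine ⟨hz', ?_, ?_, ?_, ?_, ?_⟩
  · exact exists_isLeast_ad_pow h hR.mul_mem hx hker zero_ne_one (hR.braidedAd_basis e hb 0) hb1 hN1
  · rw [mul_comm (b 0 1)]
    exact exists_isLeast_ad_pow h hR.mul_mem hx hker one_ne_zero (hR.braidedAd_basis e hb 1) hb2 hN2
  · intro hq1 hchar
    -- With `N(q) = ∞` every power of `z` belongs to the independent family.
    have hN : nicholsN q = ⊤ := by rw [nicholsN, if_pos hq1, if_pos hchar]
    refine ⟨fun n => commutator_pow_ne_zero h hz' hb12 hq (hN ▸ ENat.natCast_lt_top n), fun hfd => ?_⟩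
    rw [hN, ENat.mul_top (mul_ne_zero (nicholsN_ne_zero _) (nicholsN_ne_zero _)), top_le_iff,
      Cardinal.toENat_eq_top] at hrank
    exact hrank.not_gt (Module.rank_lt_aleph0 k R)
  · intro hq1 hchar
    have hN : nicholsN q = ringChar k := by rw [nicholsN, if_pos hq1, if_neg hchar]
    rwa [hN] at hrank
  · intro hb0 hb1'
    obtain ⟨B, hB⟩ := exists_basis_of_neg_one h hR.mul_mem hx hker hz' hk hgen hb12 hb0 hb1' hq
    exact ⟨toENat_rank_of_basis B, B, hB⟩
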